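/- **Setting.** Let $c>1$, $\gamma>0$, $\zeta=c$, and $T_k=(c-1)c^{k-1}$, $\lambda_k=\gamma\,\zeta^{1-k}$, $\pi_k=2^{-k}$ for $k\ge 1$. The critical Tokunaga tree $T$ is the random finite binary planted rooted tree with edge (link) lengths produced by the Random Attachment Model with these parameters: the order $K$ of the tree has the distribution $(\pi_K)$; streams of order $j$ have exponential lengths with rate $\lambda_j$; to every stream of order $j$, streams of order $i<j$ are attached at the points of a Poisson process of intensity $\lambda_jT_{j-i}$ along the stream, and if $j>1$ two streams of order $j-1$ are attached to its upstream end; all these choices are independent. (This is the self-similar Random Attachment Model, whose order has the distribution $p(1-p)^{K-1}$, with $p=\tfrac12$.) The order $\mathrm{ord}$ is the Horton–Strahler order, and a stream of order $k$ is a maximal chain of links of order $k$. The local contributing area of a link is a function $g\ge 0$ of its length; $g$ is measurable and the mean local area $\int_0^\infty g(x)\gamma e^{-\gamma x}\,dx$ of a source link is positive and finite. Put $$\Lambda_i=\mathsf E[\mathrm{height}(T)\mid \mathrm{ord}(T)=i],\qquad A_i=\mathsf E\Big[\sum_{\text{links }e\text{ of }T} g(\mathrm{length}(e))\,\Big|\,\mathrm{ord}(T)=i\Big],$$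 the mean length of the longest stream (the largest distance from the root to a leaf) and the mean total contributing area of a basin of order $i$. Let $w_0$ be the only root in $(0,\tfrac12]$ of $\hat t(z)=-1+2z+\sum_{k\ge1}T_kz^k$. Let $R_B>1$ be the Horton exponent of stream numbers: the mean number $\mathcal N_1[K]$ of streams of order $1$ in a tree of order $K$ satisfies $\mathcal N_1[K]R_B^{-K}\to M$ with $0<M<\infty$. Let $R_L>1$ be the Horton exponent of stream lengths: the mean length of a stream of order $j$ (equivalently, of the root stream of a tree of order $j$) is $L_j=\mathrm{Const.}\times R_L^{\,j}$, $j\ge 1$, with a positive constant. Let $\mathbf d=\max\{1,\mathbf d_0\}$ be the fractal dimension of the tree in the limit of infinite order, with lengths scaled by $\zeta$ from one order to the next, in the following sense: $m_k$ is the mean number of subtrees of order $i$ attached to the root stream (including the two at its upstream end) of a tree of order $i+k$, which does not depend on $i\ge 1$, and $\mathbf d_0$ is the exponent in which a mean volume $V\in(0,\infty)$ is preserved when the limit tree is split into the subtrees attached to its root stream, i.e. $V=\sum_{k\ge1}m_k\,V\,\zeta^{-\mathbf d_0k}$. **Theorem (Hack's law in a critical Tokunaga tree).** For every $i\ge 1$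 the averages $\Lambda_i$ and $A_i$ are finite, the quantities $w_0,R_B,R_L,\mathbf d$ exist, and there is a constant $C\in(0,\infty)$ such that $$\Lambda_i\sim C\,(A_i)^{\mathbf h}\quad(i\to\infty),\qquad \mathbf h=\mathbf d^{-1}=-\frac{\log\zeta}{\log w_0}=\frac{\log R_L}{\log R_B},$$ where $x_i\sim y_i$ means $x_i/y_i\to1$. -/

import Mathlib

open MeasureTheory ProbabilityTheory Filter Topology Asymptotics
open scoped ENNReal

noncomputable section

/-! ### River trees -/

/-- Nonempty finite binary planted rooted trees with link lengths. A tree starts at the outlet with a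
link of length `len`; this link either ends at a source, or at a junction where two subtrees meet. -/
inductive RiverTree : Type
  | source (len : ℝ) : RiverTree
  | junction (len : ℝ) (t₁ t₂ : RiverTree) : RiverTree

namespace RiverTree

/-- Is there a link at the given address (`[]` is the outlet link, `false` and `true` select the
first and the second subtree)? -/
def hasLink : RiverTree → List Bool → Bool
  | _, [] => true
  | source _, _ :: _ => false
  | junction _ t₁ t₂, b :: l => if b then t₂.hasLink l else t₁.hasLink l

/-- The length of the link at the given address (`0` if there is none). -/
def linkLength : RiverTree → List Bool → ℝ
  | source x, [] => x
  | junction x _ _, [] => x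
  | source _, _ :: _ => 0
  | junction _ t₁ t₂, b :: l => if b then t₂.linkLength l else t₁.linkLength l

/-- The Borel structure of the space of trees: the presence and the length of every link are
measurable. -/
instance : MeasurableSpace RiverTree :=
  MeasurableSpace.comap (fun t (a : List Bool) => (t.hasLink a, t.linkLength a)) inferInstance

/-- The Horton-Strahler order. -/
def ord : RiverTree → ℕ
  | source _ => 1
  | junction _ t₁ t₂ => if t₁.ord = t₂.ord then t₁.ord + 1 else max t₁.ord t₂.ord

/-- The length of the longest stream: the largest distance from the outlet to a source. -/
def height : RiverTree → ℝ
  | source x => x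
  | junction x t₁ t₂ => x + max t₁.height t₂.height

/-- The total contributing area, when a link of length `x` has the local contributing area `g x`. -/
def area (g : ℝ → ℝ) : RiverTree → ℝ
  | source x => g x
  | junction x t₁ t₂ => g x + (t₁.area g + t₂.area g)

/-- The number of streams of order `i` (a stream is a maximal chain of links of the same order):
a stream of order `1` begins at every source, and a stream of order `k + 1` at every junction of two
links of order `k`. -/
def streamCount (i : ℕ) : RiverTree → ℕ
  | source _ => if i = 1 then 1 else 0
  | junction _ t₁ t₂ => t₁.streamCount i + t₂.streamCount i +
      if t₁.ord = t₂.ord ∧ i = t₁.ord + 1 then 1 else 0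

/-- The length of the root stream, that is of the stream that ends at the outlet. -/
def rootStreamLength : RiverTree → ℝ
  | source x => x
  | junction x t₁ t₂ => x +
      if t₂.ord < t₁.ord then t₁.rootStreamLength
      else if t₁.ord < t₂.ord then t₂.rootStreamLength
      else 0

/-- The number of subtrees of order `i` that are attached to the root stream: the side tributaries,
and the two subtrees that meet at its upstream end. -/
def attachedCount (i : ℕ) : RiverTree → ℕ
  | source _ => 0
  | junction _ t₁ t₂ =>
      if t₂.ord < t₁.ord then t₁.attachedCount i + (if t₂.ord = i then 1 else 0)
      else if t₁.ord < t₂.ord then t₂.attachedCount i + (if t₁.ord = i then 1 else 0)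
      else if t₁.ord = i then 2 else 0

/-- The part upstream of position `x` of the tree formed by a stream of length `ℓ` to which trees
are attached at the listed positions (positions are measured from the lower end of the stream and
increase along the list), and at whose upstream end the trees `a` and `b` meet. -/
def assemble (ℓ : ℝ) (a b : RiverTree) : ℝ → List (ℝ × RiverTree) → RiverTree
  | x, [] => junction (ℓ - x) a b
  | x, (y, t) :: l => junction (y - x) t (assemble ℓ a b y l)

end RiverTree

/-! ### Poisson attachment and the Random Attachment Model -/

/-- The law of a Poisson point process on `ℝ × M` with finite intensity measure `μ` (without atoms
in the first coordinate), its points being listed in the order of their first coordinates: on the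
event that there are `n` points, it has the density `exp (-μ (ℝ × M))` with respect to `μⁿ` on the
set of ordered `n`-tuples. -/
def poissonLaw {M : Type*} [MeasurableSpace M] (μ : Measure (ℝ × M)) :
    Measure (Σ n : ℕ, Fin n → ℝ × M) :=
  ENNReal.ofReal (Real.exp (-(μ Set.univ).toReal)) •
    Measure.sum fun n : ℕ =>
      ((Measure.pi fun _ : Fin n => μ).restrict {x | StrictMono fun i => (x i).1}).map (Sigma.mk n)

/-- The law of the tree with a root stream of length `ℓ`, when trees are attached to the root stream
by a Poisson process with intensity `ν` per unit of length (`ν` is a finite measure on trees: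
a tree in `S` is attached at rate `ν S`), and two independent trees with law `η` are attached to its
upstream end. -/
def attachLaw (ν η : Measure RiverTree) (ℓ : ℝ) : Measure RiverTree :=
  ((poissonLaw ((volume.restrict (Set.Ioc 0 ℓ)).prod ν)).prod (η.prod η)).map
    fun p => RiverTree.assemble ℓ p.2.1 p.2.2 0 (List.ofFn p.1.2)

/-- The law of the tree of order `K` in the Random Attachment Model with Tokunaga sequence `T` and
stream length rates `lam`. Streams of order `j` have exponential lengths with rate `lam j`; for every
`i < j`, streams of order `i` are attached to every stream of order `j` by a Poisson process of
intensity `lam j * T (j - i)`, and two streams of order `j - 1` are attached to its upstream end if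
`j > 1`; everything is independent. -/
def ramTree (T lam : ℕ → ℝ) : ℕ → Measure RiverTree
  | 0 => 0
  | 1 => (expMeasure (lam 1)).map RiverTree.source
  | K + 2 => (expMeasure (lam (K + 2))).bind
      (attachLaw
        (∑ i : Fin (K + 1),
          ENNReal.ofReal (lam (K + 2) * T (K + 2 - (i + 1))) • ramTree T lam (i + 1))
        (ramTree T lam (K + 1)))

/-- The law of the random tree of the Random Attachment Model: the order `K ≥ 1` has the
distribution `π`. -/
def ramLaw (T lam π : ℕ → ℝ) : Measure RiverTree :=
  Measure.sum fun K : ℕ => ENNReal.ofReal (π (K + 1)) • ramTree T lam (K + 1)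

/-- The law of the self-similar Random Attachment Model with Tokunaga sequence `T` and parameters
`p`, `γ`, `ζ`: the order has the distribution `p (1 - p) ^ (K - 1)`, and streams of order `j` have
the rate `γ ζ ^ (1 - j)`. -/
def selfSimilarRamLaw (T : ℕ → ℝ) (p γ ζ : ℝ) : Measure RiverTree :=
  ramLaw T (fun j => γ * ζ ^ (1 - (j : ℤ))) (fun K => p * (1 - p) ^ (K - 1))

/-- The Tokunaga sequence `T_k = (c - 1) c ^ (k - 1)`, `k ≥ 1`. -/
def tokunagaSeq (c : ℝ) (k : ℕ) : ℝ := (c - 1) * c ^ (k - 1)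

/-- The law of the critical Tokunaga tree: `p = 1 / 2`, `ζ = c`. -/
def criticalTokunagaLaw (c γ : ℝ) : Measure RiverTree :=
  selfSimilarRamLaw (tokunagaSeq c) (1 / 2) γ c

/-! ### Averages, Horton exponents, fractal dimension -/

/-- The law of a random tree conditioned on having order `k`. -/
def givenOrder (P : Measure RiverTree) (k : ℕ) : Measure RiverTree :=
  ProbabilityTheory.cond P {t | t.ord = k}

/-- The average of an attribute `f` over trees of order `k`: `E [f(T) | ord T = k]`. -/
def meanAtOrder (P : Measure RiverTree) (f : RiverTree → ℝ) (k : ℕ) : ℝ :=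
  ∫ t, f t ∂(givenOrder P k)

/-- `R` is the Horton exponent of stream numbers: the mean number `N k` of streams of order `1` in a
tree of order `k` satisfies `N k * R ^ (-k) → M` with `0 < M < ∞`. -/
def IsStreamNumberExponent (P : Measure RiverTree) (R : ℝ) : Prop :=
  1 < R ∧ ∃ M : ℝ, 0 < M ∧
    Tendsto (fun k : ℕ => meanAtOrder P (fun t => (t.streamCount 1 : ℝ)) k / R ^ k) atTop (𝓝 M)

/-- `R` is the Horton exponent of stream lengths: the mean length of a stream of order `j` is
proportional to `R ^ j`. -/
def IsStreamLengthExponent (P : Measure RiverTree) (R : ℝ) : Prop :=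
  1 < R ∧ ∃ C : ℝ, 0 < C ∧ ∀ j : ℕ, 1 ≤ j → meanAtOrder P RiverTree.rootStreamLength j = C * R ^ j

/-- `z` is a root of `-1 + 2 z + ∑ k ≥ 1, T_k z ^ k` (the series converges at `z`). -/
def IsRootOfTHat (T : ℕ → ℝ) (z : ℝ) : Prop :=
  ∃ s : ℝ, HasSum (fun k : ℕ => T (k + 1) * z ^ (k + 1)) s ∧ -1 + 2 * z + s = 0

/-- `d` is the fractal dimension of the tree in the limit of infinite order, when lengths scale by
`ζ` from one order to the next. Splitting the tree into the subtrees that are attached to its root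
stream gives, for each `k ≥ 1`, on average `m k` copies of the tree scaled by `ζ ^ (-k)`, where
`m k` is the mean number of subtrees of order `i` attached to the root stream of a tree of order
`i + k`, for any `i`. The dimension is the larger of `1` (the dimension of the root stream) and
the exponent `d₀` in which a finite positive mean volume `V` is preserved by this splitting. -/
def IsFractalDimension (P : Measure RiverTree) (ζ d : ℝ) : Prop :=
  ∃ (m : ℕ → ℝ) (d₀ V : ℝ),
    (∀ i k : ℕ, 1 ≤ i → 1 ≤ k →
      meanAtOrder P (fun t => (t.attachedCount i : ℝ)) (i + k) = m k) ∧
    0 < V ∧ HasSum (fun k : ℕ => m (k + 1) * (V / ζ ^ (d₀ * (k + 1)))) V ∧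
    d = max 1 d₀

end

/-! ### Measurability of functionals of trees -/

namespace RiverTree

/-! A stream of order K + 1 has rate γ c^(-K), and side trees are attached to it with total
intensity γ c^(-K) (c^K - 1). These two rates add up to γ for every K, which is where ζ = c enters.
Hence every link is exponential with rate γ. Above the outlet link of a tree of order K + 1, K ≥ 1,
there are two trees of order K with probability c^(-K); otherwise there is a side tree and a
remainder with the same law as the whole tree (`lintegral_criticalTree_add_two`).

If a functional is additive along the root stream, this decomposition is a linear equation for its
mean, solved in `lintegral_criticalTree_of_root_additive`. It yields the mean number of sources
(`leafMean`), which grows like (2c)^K, the mean area, the mean root stream length and the mean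
numbers of attached trees. It follows that w₀ = 1/(2c), R_B = 2c, R_L = c and d = log(2c) / log c.

The height is not additive, and pruning is used for it. When the streams of order 1 are cut off, the
junctions with side trees of order 1 disappear, and a new link is a geometric sum, with parameter
1/c, of exponential links of rate γ. Such a sum is exponential with rate γ/c, so pruning lowers the
order by 1 and multiplies lengths by c. Only the consequence for the height is needed
(`map_prunedHeight`). It is proved by showing that both distribution functions solve the same
recursion, whose solution is unique by contraction (`le_of_contraction`).

Pruning lowers the height by at most the length of the longest source link, and the mean of that
length is of the order of the logarithm of the number of sources, that is O(K). Hence c Λ_K ≤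
Λ_(K+1) ≤ c Λ_K + O(K), and Λ_K / c^K increases to a finite positive limit
(`exists_tendsto_integral_height`). Since A_K is asymptotic to a multiple of (2c)^K, the exponent is
log c / log(2c). -/

theorem measurable_iff {X : Type*} [MeasurableSpace X] {f : X → RiverTree} :
    Measurable f ↔ ∀ a, (Measurable fun x => (f x).hasLink a) ∧
      Measurable fun x => (f x).linkLength a := by
  refine measurable_comap_iff.trans (measurable_pi_iff.trans (forall_congr' fun a => ?_))
  exact ⟨fun h => ⟨h.fst, h.snd⟩, fun h => h.1.prodMk h.2⟩

theorem measurable_hasLink (a : List Bool) : Measurable fun t : RiverTree => t.hasLink a :=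
  (measurable_iff.1 measurable_id a).1

theorem measurable_linkLength (a : List Bool) : Measurable fun t : RiverTree => t.linkLength a :=
  (measurable_iff.1 measurable_id a).2

theorem measurable_source : Measurable source := by
  refine measurable_iff.2 fun a => ?_
  cases a with
  | nil => exact ⟨measurable_const, measurable_id⟩
  | cons b l => exact ⟨measurable_const, measurable_const⟩

theorem measurable_junction :
    Measurable fun q : ℝ × RiverTree × RiverTree => junction q.1 q.2.1 q.2.2 := by
  refine measurable_iff.2 fun a => ?_
  cases a with
  | nil => exact ⟨measurable_const, measurable_fst⟩
  | cons b l =>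
    cases b
    · exact ⟨(measurable_hasLink l).comp (measurable_fst.comp measurable_snd),
        (measurable_linkLength l).comp (measurable_fst.comp measurable_snd)⟩
    · exact ⟨(measurable_hasLink l).comp (measurable_snd.comp measurable_snd),
        (measurable_linkLength l).comp (measurable_snd.comp measurable_snd)⟩

theorem _root_.Measurable.riverJunction {X : Type*} [MeasurableSpace X] {f : X → ℝ}
    {a b : X → RiverTree} (hf : Measurable f) (ha : Measurable a) (hb : Measurable b) :
    Measurable fun x => junction (f x) (a x) (b x) :=
  measurable_junction.comp (hf.prodMk (ha.prodMk hb))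

/-- The subtree on the given side of the junction at the upper end of the outlet link
(the tree itself if the outlet link ends at a source). -/
def child (b : Bool) : RiverTree → RiverTree
  | source x => source x
  | junction _ t₁ t₂ => if b then t₂ else t₁

theorem measurable_child (b : Bool) : Measurable (child b) := by
  -- The address `[false]` exists exactly in junctions, so this event separates junctions from
  -- sources.
  have hs : MeasurableSet {t : RiverTree | t.hasLink [false] = true} :=
    measurable_hasLink _ (measurableSet_singleton true)
  refine measurable_iff.2 fun a => ⟨?_, ?_⟩
  · have h : (fun t => (child b t).hasLink a) =
        fun t => if t.hasLink [false] = true then t.hasLink (b :: a) else t.hasLink a := by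
      funext t
      cases t <;> cases b <;> simp [hasLink, child]
    rw [h]
    exact Measurable.ite hs (measurable_hasLink (b :: a)) (measurable_hasLink a)
  · have h : (fun t => (child b t).linkLength a) =
        fun t => if t.hasLink [false] = true then t.linkLength (b :: a) else t.linkLength a := by
      funext t
      cases t <;> cases b <;> simp [hasLink, linkLength, child]
    rw [h]
    exact Measurable.ite hs (measurable_linkLength (b :: a)) (measurable_linkLength a)

/-- The largest number of junctions between the outlet and a source. -/
def depth : RiverTree → ℕ
  | source _ => 0
  | junction _ t₁ t₂ => max t₁.depth t₂.depth + 1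

theorem measurableSet_depth_le (n : ℕ) : MeasurableSet {t : RiverTree | t.depth ≤ n} := by
  have hs : MeasurableSet {t : RiverTree | t.hasLink [false] = true} :=
    measurable_hasLink _ (measurableSet_singleton true)
  induction n with
  | zero =>
    convert hs.compl using 1
    ext t
    cases t <;> simp [depth, hasLink]
  | succ n ih =>
    convert hs.compl.union ((measurable_child false ih).inter (measurable_child true ih)) using 1
    ext t
    cases t <;> simp [depth, hasLink, child]

/-- A functional that is computed recursively by measurable functions is measurable. -/
theorem measurable_of_rec {β : Type*} [MeasurableSpace β] {f : RiverTree → β} {φ : ℝ → β}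
    {ψ : ℝ × β × β → β} (hφ : Measurable φ) (hψ : Measurable ψ) (hsource : ∀ x, f (source x) = φ x)
    (hjunction : ∀ x a b, f (junction x a b) = ψ (x, f a, f b)) : Measurable f := by
  have hs : MeasurableSet {t : RiverTree | t.hasLink [false] = true} :=
    measurable_hasLink _ (measurableSet_singleton true)
  -- On trees of depth at most `n` the recursion can be unfolded `n` times into a measurable `F`.
  -- These sets of trees are measurable and exhaust the space.
  have key : ∀ n : ℕ, ∃ F : RiverTree → β, Measurable F ∧ ∀ t, t.depth ≤ n → f t = F t := by
    intro n
    induction n with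
    | zero =>
      refine ⟨fun t => φ (t.linkLength []), hφ.comp (measurable_linkLength []), fun t ht => ?_⟩
      cases t with
      | source x => simp [hsource, linkLength]
      | junction x a b => simp [depth] at ht
    | succ n ih =>
      obtain ⟨F, hF, hfF⟩ := ih
      refine ⟨fun t => if t.hasLink [false] = true
          then ψ (t.linkLength [], F (t.child false), F (t.child true)) else φ (t.linkLength []),
        Measurable.ite hs (hψ.comp ((measurable_linkLength []).prodMk
          ((hF.comp (measurable_child _)).prodMk (hF.comp (measurable_child _)))))
          (hφ.comp (measurable_linkLength [])), fun t ht => ?_⟩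
      cases t with
      | source x => simp [hsource, linkLength, hasLink]
      | junction x a b =>
        simp only [depth, Nat.add_le_add_iff_right, max_le_iff] at ht
        simp [hjunction, linkLength, hasLink, child, hfF a ht.1, hfF b ht.2]
  choose F hF hfF using key
  intro S hS
  have : f ⁻¹' S = ⋃ n, {t | t.depth ≤ n} ∩ F n ⁻¹' S := by
    ext t
    simp only [Set.mem_preimage, Set.mem_iUnion, Set.mem_inter_iff, Set.mem_ofPred_eq]
    constructor
    · intro h
      exact ⟨t.depth, le_rfl, by rwa [← hfF _ _ le_rfl]⟩
    · rintro ⟨n, hn, h⟩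
      rwa [hfF n t hn]
  rw [this]
  exact MeasurableSet.iUnion fun n => (measurableSet_depth_le n).inter (hF n hS)

theorem measurable_ord : Measurable ord :=
  measurable_of_rec (φ := fun _ => 1)
    (ψ := fun q => if q.2.1 = q.2.2 then q.2.1 + 1 else max q.2.1 q.2.2) measurable_const
    (Measurable.ite (measurableSet_eq_fun (by fun_prop) (by fun_prop)) (by fun_prop)
      (by fun_prop)) (fun _ => rfl) (fun _ _ _ => rfl)

theorem measurable_height : Measurable height :=
  measurable_of_rec (φ := id) (ψ := fun q => q.1 + max q.2.1 q.2.2) measurable_id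
    (by fun_prop) (fun _ => rfl) (fun _ _ _ => rfl)

theorem measurable_area {g : ℝ → ℝ} (hg : Measurable g) : Measurable (area g) :=
  measurable_of_rec (φ := g) (ψ := fun q => g q.1 + (q.2.1 + q.2.2)) hg
    (by fun_prop) (fun _ => rfl) (fun _ _ _ => rfl)

/-- The recursion also uses the orders of the two subtrees, so it closes only for the pair with
`ord`. The same device serves `attachedCount` and `rootStreamLength`. -/
theorem measurable_streamCount (i : ℕ) : Measurable (streamCount i) := by
  refine measurable_fst.comp (measurable_of_rec (f := fun t => (t.streamCount i, t.ord))
    (φ := fun _ => (if i = 1 then 1 else 0, 1))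
    (ψ := fun q => (q.2.1.1 + q.2.2.1 + if q.2.1.2 = q.2.2.2 ∧ i = q.2.1.2 + 1 then 1 else 0,
      if q.2.1.2 = q.2.2.2 then q.2.1.2 + 1 else max q.2.1.2 q.2.2.2)) measurable_const
    ?_ (fun _ => rfl) (fun _ _ _ => rfl))
  exact (measurable_of_countable fun z : (ℕ × ℕ) × (ℕ × ℕ) =>
    (z.1.1 + z.2.1 + if z.1.2 = z.2.2 ∧ i = z.1.2 + 1 then 1 else 0,
      if z.1.2 = z.2.2 then z.1.2 + 1 else max z.1.2 z.2.2)).comp measurable_snd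

theorem measurable_attachedCount (i : ℕ) : Measurable (attachedCount i) := by
  refine measurable_fst.comp (measurable_of_rec (f := fun t => (t.attachedCount i, t.ord))
    (φ := fun _ => (0, 1))
    (ψ := fun q => (if q.2.2.2 < q.2.1.2 then q.2.1.1 + (if q.2.2.2 = i then 1 else 0)
      else if q.2.1.2 < q.2.2.2 then q.2.2.1 + (if q.2.1.2 = i then 1 else 0)
      else if q.2.1.2 = i then 2 else 0,
      if q.2.1.2 = q.2.2.2 then q.2.1.2 + 1 else max q.2.1.2 q.2.2.2)) measurable_const
    ?_ (fun _ => rfl) (fun _ _ _ => rfl))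
  exact (measurable_of_countable fun z : (ℕ × ℕ) × (ℕ × ℕ) =>
    (if z.2.2 < z.1.2 then z.1.1 + (if z.2.2 = i then 1 else 0)
      else if z.1.2 < z.2.2 then z.2.1 + (if z.1.2 = i then 1 else 0)
      else if z.1.2 = i then 2 else 0,
      if z.1.2 = z.2.2 then z.1.2 + 1 else max z.1.2 z.2.2)).comp measurable_snd

theorem measurable_rootStreamLength : Measurable rootStreamLength := by
  refine measurable_fst.comp (measurable_of_rec (f := fun t => (t.rootStreamLength, t.ord))
    (φ := fun x => (x, 1))
    (ψ := fun q => (q.1 + if q.2.2.2 < q.2.1.2 then q.2.1.1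
      else if q.2.1.2 < q.2.2.2 then q.2.2.1 else 0,
      if q.2.1.2 = q.2.2.2 then q.2.1.2 + 1 else max q.2.1.2 q.2.2.2))
    (measurable_id.prodMk measurable_const) ?_ (fun _ => rfl) (fun _ _ _ => rfl))
  refine Measurable.prodMk (measurable_fst.add (Measurable.ite
    (measurableSet_lt (by fun_prop) (by fun_prop)) (by fun_prop) (Measurable.ite
    (measurableSet_lt (by fun_prop) (by fun_prop)) (by fun_prop) (by fun_prop))))
    (Measurable.ite (measurableSet_eq_fun (by fun_prop) (by fun_prop)) (by fun_prop)
      (by fun_prop))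

theorem measurable_assemble (n : ℕ) {X : Type*} [MeasurableSpace X] {ℓ s : X → ℝ}
    {a b : X → RiverTree} {l : X → Fin n → ℝ × RiverTree} (hℓ : Measurable ℓ) (ha : Measurable a)
    (hb : Measurable b) (hs : Measurable s) (hl : Measurable l) :
    Measurable fun q => assemble (ℓ q) (a q) (b q) (s q) (List.ofFn (l q)) := by
  induction n generalizing s with
  | zero =>
    simp only [List.ofFn_zero, assemble]
    exact (hℓ.sub hs).riverJunction ha hb
  | succ n ih =>
    have h0 : Measurable fun q => l q 0 := measurable_pi_iff.1 hl 0
    simp only [List.ofFn_succ, assemble]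
    refine (h0.fst.sub hs).riverJunction h0.snd (ih h0.fst ?_)
    exact measurable_pi_iff.2 fun i => measurable_pi_iff.1 hl i.succ

end RiverTree

/-! ### The first link of a stream with Poisson attachment -/

namespace RiverTree

/-- The positions of the listed points increase and lie in `(s, ℓ]`. -/
def IsAttachment {n : ℕ} (s ℓ : ℝ) (x : Fin n → ℝ × RiverTree) : Prop :=
  (∀ i, s < (x i).1 ∧ (x i).1 ≤ ℓ) ∧ StrictMono fun i => (x i).1

/-- This splits off the lowest attached tree: its position becomes the new base point for the other
trees. -/
theorem isAttachment_cons {n : ℕ} {s ℓ : ℝ} {q : ℝ × RiverTree} {x : Fin n → ℝ × RiverTree} :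
    IsAttachment s ℓ (Fin.cons q x : Fin (n + 1) → ℝ × RiverTree) ↔
      (s < q.1 ∧ q.1 ≤ ℓ) ∧ IsAttachment q.1 ℓ x := by
  constructor
  · rintro ⟨h, hm⟩
    refine ⟨by simpa using h 0, fun i => ⟨?_, by simpa using (h i.succ).2⟩, fun i j hij => ?_⟩
    · simpa using hm (Fin.succ_pos i)
    · simpa using hm (Fin.succ_lt_succ_iff.2 hij)
  · rintro ⟨h0, h, hm⟩
    refine ⟨fun i => ?_, fun i j hij => ?_⟩
    · refine Fin.cases ?_ (fun i => ?_) i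
      · simpa using h0
      · simpa using ⟨h0.1.trans (h i).1, (h i).2⟩
    · induction i using Fin.cases with
      | zero =>
        induction j using Fin.cases with
        | zero => exact absurd hij (lt_irrefl _)
        | succ j => simpa using (h j).1
      | succ i =>
        induction j using Fin.cases with
        | zero => exact absurd hij (Fin.not_lt_zero _)
        | succ j => simpa using hm (Fin.succ_lt_succ_iff.1 hij)

theorem measurableSet_isAttachment {X : Type*} [MeasurableSpace X] {n : ℕ} {s ℓ : X → ℝ}
    {x : X → Fin n → ℝ × RiverTree} (hs : Measurable s) (hℓ : Measurable ℓ) (hx : Measurable x) :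
    MeasurableSet {z | IsAttachment (s z) (ℓ z) (x z)} := by
  have hi : ∀ i, Measurable fun z => (x z i).1 := fun i => (measurable_pi_iff.1 hx i).fst
  have h : {z | IsAttachment (s z) (ℓ z) (x z)} =
      (⋂ i, {z | s z < (x z i).1} ∩ {z | (x z i).1 ≤ ℓ z}) ∩
        ⋂ i, ⋂ j, ⋂ _ : i < j, {z | (x z i).1 < (x z j).1} := by
    ext z
    simp [IsAttachment, StrictMono]
  rw [h]
  exact (MeasurableSet.iInter fun i => (measurableSet_lt hs (hi i)).inter
    (measurableSet_le (hi i) hℓ)).inter (MeasurableSet.iInter fun i => MeasurableSet.iInter fun j =>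
      MeasurableSet.iInter fun _ => measurableSet_lt (hi i) (hi j))

open Classical in
/-- The integral of `f` over the trees that consist of the part above `s` of a stream of length `ℓ`
with `n` attached trees. -/
noncomputable def streamIntegral (ν η : Measure RiverTree) (n : ℕ) (f : RiverTree → ℝ≥0∞)
    (s ℓ : ℝ) : ℝ≥0∞ :=
  ∫⁻ x, (if IsAttachment s ℓ x then
      ∫⁻ p, f (assemble ℓ p.1 p.2 s (List.ofFn x)) ∂(η.prod η) else 0)
    ∂(Measure.pi fun _ : Fin n => (volume : Measure ℝ).prod ν)

variable (ν η : Measure RiverTree) [IsFiniteMeasure ν] [IsFiniteMeasure η]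

set_option linter.unusedSectionVars false

/-- The integrand `F z` may depend on the parameter because splitting off a link turns `f` into `fun
t' => f (junction x t t')`, and `x` and `t` are integrated afterwards. -/
theorem measurable_lintegral_assemble {n : ℕ} {Z : Type*} [MeasurableSpace Z]
    {F : Z → RiverTree → ℝ≥0∞} (hF : Measurable (Function.uncurry F)) {s ℓ : Z → ℝ}
    (hs : Measurable s) (hℓ : Measurable ℓ) {x : Z → Fin n → ℝ × RiverTree} (hx : Measurable x) :
    Measurable fun z =>
      ∫⁻ p, F z (assemble (ℓ z) p.1 p.2 (s z) (List.ofFn (x z))) ∂(η.prod η) := by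
  refine Measurable.lintegral_prod_right'
    (f := fun w : Z × RiverTree × RiverTree =>
      F w.1 (assemble (ℓ w.1) w.2.1 w.2.2 (s w.1) (List.ofFn (x w.1)))) ?_
  exact hF.comp (measurable_fst.prodMk (measurable_assemble n (hℓ.comp measurable_fst)
    measurable_snd.fst measurable_snd.snd (hs.comp measurable_fst) (hx.comp measurable_fst)))

open Classical in
theorem measurable_ite_lintegral_assemble {n : ℕ} {Z : Type*} [MeasurableSpace Z]
    {F : Z → RiverTree → ℝ≥0∞} (hF : Measurable (Function.uncurry F)) {s ℓ : Z → ℝ}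
    (hs : Measurable s) (hℓ : Measurable ℓ) {x : Z → Fin n → ℝ × RiverTree} (hx : Measurable x) :
    Measurable fun z => if IsAttachment (s z) (ℓ z) (x z) then
      ∫⁻ p, F z (assemble (ℓ z) p.1 p.2 (s z) (List.ofFn (x z))) ∂(η.prod η) else 0 :=
  Measurable.ite (measurableSet_isAttachment hs hℓ hx)
    (measurable_lintegral_assemble η hF hs hℓ hx) measurable_const

theorem measurable_streamIntegral (n : ℕ) {Z : Type*} [MeasurableSpace Z]
    {F : Z → RiverTree → ℝ≥0∞} (hF : Measurable (Function.uncurry F)) {s ℓ : Z → ℝ}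
    (hs : Measurable s) (hℓ : Measurable ℓ) :
    Measurable fun z => streamIntegral ν η n (F z) (s z) (ℓ z) := by
  classical
  refine Measurable.lintegral_prod_right' (f := fun w : Z × (Fin n → ℝ × RiverTree) =>
    if IsAttachment (s w.1) (ℓ w.1) w.2 then
      ∫⁻ p, F w.1 (assemble (ℓ w.1) p.1 p.2 (s w.1) (List.ofFn w.2)) ∂(η.prod η) else 0) ?_
  refine measurable_ite_lintegral_assemble η (F := fun w : Z × (Fin n → ℝ × RiverTree) => F w.1)
    ?_ (hs.comp measurable_fst) (hℓ.comp measurable_fst) measurable_snd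
  exact hF.comp (measurable_fst.fst.prodMk measurable_snd)

theorem measurable_comp_junction {f : RiverTree → ℝ≥0∞} (hf : Measurable f) (x : ℝ)
    (t : RiverTree) : Measurable fun t' => f (junction x t t') :=
  hf.comp (measurable_const.riverJunction measurable_const measurable_id)

theorem measurable_uncurry_junction {f : RiverTree → ℝ≥0∞} (hf : Measurable f) (s : ℝ) :
    Measurable (Function.uncurry fun (q : ℝ × RiverTree) t' => f (junction (q.1 - s) q.2 t')) :=
  hf.comp ((measurable_fst.fst.sub measurable_const).riverJunction measurable_fst.snd
    measurable_snd)

theorem streamIntegral_zero (f : RiverTree → ℝ≥0∞) (s ℓ : ℝ) :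
    streamIntegral ν η 0 f s ℓ = ∫⁻ p, f (junction (ℓ - s) p.1 p.2) ∂(η.prod η) := by
  have h : ∀ x : Fin 0 → ℝ × RiverTree, IsAttachment s ℓ x := fun x =>
    ⟨fun i => i.elim0, fun i => i.elim0⟩
  simp [streamIntegral, h, assemble]

theorem streamIntegral_succ (n : ℕ) {f : RiverTree → ℝ≥0∞} (hf : Measurable f) (s ℓ : ℝ) :
    streamIntegral ν η (n + 1) f s ℓ = ∫⁻ q : ℝ × RiverTree, (if s < q.1 ∧ q.1 ≤ ℓ then
      streamIntegral ν η n (fun t' => f (junction (q.1 - s) q.2 t')) q.1 ℓ else 0)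
        ∂((volume : Measure ℝ).prod ν) := by
  classical
  have hmp := (measurePreserving_piFinSuccAbove
    (fun _ : Fin (n + 1) => (volume : Measure ℝ).prod ν) 0).symm
  have hm := measurable_ite_lintegral_assemble (n := n + 1) η
    (F := fun _ : Fin (n + 1) → ℝ × RiverTree => f) (hf.comp measurable_snd)
    (measurable_const (a := s)) (measurable_const (a := ℓ)) measurable_id
  simp only [id] at hm
  rw [streamIntegral, ← hmp.lintegral_comp hm]
  refine (lintegral_prod _ (hm.comp hmp.measurable).aemeasurable).trans ?_
  refine lintegral_congr fun q => ?_
  have he : ∀ x : Fin n → ℝ × RiverTree,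
      (MeasurableEquiv.piFinSuccAbove (fun _ : Fin (n + 1) => ℝ × RiverTree) 0).symm (q, x) =
        (Fin.cons q x : Fin (n + 1) → ℝ × RiverTree) := fun x => by
    rw [← Fin.insertNth_zero']; rfl
  simp only [Function.comp_apply, he, isAttachment_cons, streamIntegral]
  by_cases hq : s < q.1 ∧ q.1 ≤ ℓ
  · simp only [hq, and_self, true_and, if_true]
    refine lintegral_congr fun x => ?_
    simp [List.ofFn_succ, assemble]
  · simp [hq]

/-- The contribution of the streams with `n` attached trees, seen from the position `s`, when the
stream and the attachment have the total rate `γ`. -/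
noncomputable def upstreamIntegral (γ : ℝ) (n : ℕ) (f : RiverTree → ℝ≥0∞) (s : ℝ) : ℝ≥0∞ :=
  ∫⁻ ℓ, (if s ≤ ℓ then ENNReal.ofReal (Real.exp (-(γ * (ℓ - s)))) *
    streamIntegral ν η n f s ℓ else 0)

theorem measurable_upstreamIntegral (γ : ℝ) (n : ℕ) {Z : Type*} [MeasurableSpace Z]
    {F : Z → RiverTree → ℝ≥0∞} (hF : Measurable (Function.uncurry F)) {s : Z → ℝ}
    (hs : Measurable s) : Measurable fun z => upstreamIntegral ν η γ n (F z) (s z) := by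
  refine Measurable.lintegral_prod_right' (f := fun w : Z × ℝ =>
    if s w.1 ≤ w.2 then ENNReal.ofReal (Real.exp (-(γ * (w.2 - s w.1)))) *
      streamIntegral ν η n (F w.1) (s w.1) w.2 else 0) ?_
  refine Measurable.ite (measurableSet_le (hs.comp measurable_fst) measurable_snd) ?_
    measurable_const
  refine Measurable.mul ?_ (measurable_streamIntegral ν η n (F := fun w : Z × ℝ => F w.1) ?_
    (hs.comp measurable_fst) measurable_snd)
  · have := hs.comp (measurable_fst : Measurable (Prod.fst : Z × ℝ → Z))
    simp only [Function.comp_def] at this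
    fun_prop
  · exact hF.comp (measurable_fst.fst.prodMk measurable_snd)

/-- The exponential weight factorizes at the lowest attached tree: exp(-γ(ℓ - s)) = exp(-γ(y - s))
exp(-γ(ℓ - y)). Fubini then integrates the length of the stream above y first. -/
theorem upstreamIntegral_succ_eq (γ : ℝ) (n : ℕ) {f : RiverTree → ℝ≥0∞} (hf : Measurable f)
    (s : ℝ) : upstreamIntegral ν η γ (n + 1) f s = ∫⁻ q : ℝ × RiverTree, (if s < q.1 then
      ENNReal.ofReal (Real.exp (-(γ * (q.1 - s)))) *
        upstreamIntegral ν η γ n (fun t' => f (junction (q.1 - s) q.2 t')) q.1 else 0)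
          ∂((volume : Measure ℝ).prod ν) := by
  have hJ : Measurable fun w : ℝ × ℝ × RiverTree =>
      streamIntegral ν η n (fun t' => f (junction (w.2.1 - s) w.2.2 t')) w.2.1 w.1 :=
    measurable_streamIntegral ν η n
      (F := fun (w : ℝ × ℝ × RiverTree) t' => f (junction (w.2.1 - s) w.2.2 t'))
      (hf.comp ((measurable_fst.snd.fst.sub measurable_const).riverJunction measurable_fst.snd.snd
        measurable_snd)) measurable_snd.fst measurable_fst
  have h1 : upstreamIntegral ν η γ (n + 1) f s = ∫⁻ ℓ : ℝ, ∫⁻ q : ℝ × RiverTree,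
      (if s < q.1 ∧ q.1 ≤ ℓ then ENNReal.ofReal (Real.exp (-(γ * (ℓ - s)))) *
        streamIntegral ν η n (fun t' => f (junction (q.1 - s) q.2 t')) q.1 ℓ else 0)
          ∂((volume : Measure ℝ).prod ν) := by
    refine lintegral_congr fun ℓ => ?_
    split_ifs with h
    · rw [streamIntegral_succ ν η n hf, ← lintegral_const_mul']
      · refine lintegral_congr fun q => ?_
        split_ifs <;> simp
      · exact ENNReal.ofReal_ne_top
    · symm
      refine (lintegral_congr fun q => if_neg ?_).trans lintegral_zero
      exact fun hq => h (hq.1.le.trans hq.2)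
  rw [h1, lintegral_lintegral_swap]
  · refine lintegral_congr fun q => ?_
    split_ifs with h
    · rw [upstreamIntegral, ← lintegral_const_mul' _ _ ENNReal.ofReal_ne_top]
      refine lintegral_congr fun ℓ => ?_
      simp only [h, true_and]
      split_ifs
      · rw [← mul_assoc, ← ENNReal.ofReal_mul (Real.exp_pos _).le, ← Real.exp_add]
        congr 4
        ring
      · simp
    · simp [h]
  · refine (Measurable.ite ((measurableSet_lt measurable_const measurable_snd.fst).inter
      (measurableSet_le measurable_snd.fst measurable_fst)) (Measurable.mul ?_ hJ)
        measurable_const).aemeasurable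
    fun_prop

/-- Memorylessness: only differences of positions enter, and Lebesgue measure is translation
invariant. This is why the part above the first junction is distributed like the whole tree. -/
theorem upstreamIntegral_eq_zero (γ : ℝ) (n : ℕ) {f : RiverTree → ℝ≥0∞} (hf : Measurable f)
    (s : ℝ) : upstreamIntegral ν η γ n f s = upstreamIntegral ν η γ n f 0 := by
  induction n generalizing f s with
  | zero =>
    simpa only [upstreamIntegral, streamIntegral_zero, sub_zero, sub_nonneg] using
      lintegral_sub_right_eq_self (μ := volume) (fun ℓ : ℝ => if 0 ≤ ℓ then
        ENNReal.ofReal (Real.exp (-(γ * ℓ))) * ∫⁻ p, f (junction ℓ p.1 p.2) ∂(η.prod η) else 0) s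
  | succ n ih =>
    have h : ∀ s, upstreamIntegral ν η γ (n + 1) f s = ∫⁻ y : ℝ, ∫⁻ t, (if 0 < y - s then
        ENNReal.ofReal (Real.exp (-(γ * (y - s)))) *
          upstreamIntegral ν η γ n (fun t' => f (junction (y - s) t t')) 0 else 0) ∂ν := by
      intro s
      rw [upstreamIntegral_succ_eq ν η γ n hf, lintegral_prod]
      · refine lintegral_congr fun y => lintegral_congr fun t => ?_
        simp only [sub_pos]
        rw [ih (measurable_comp_junction hf _ _)]
      · refine (Measurable.ite (measurableSet_lt measurable_const measurable_fst)
          (Measurable.mul (by fun_prop) ?_) measurable_const).aemeasurable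
        exact measurable_upstreamIntegral ν η γ n (measurable_uncurry_junction hf s) measurable_fst
    rw [h s, h 0]
    simp only [sub_zero]
    exact lintegral_sub_right_eq_self (fun y : ℝ => ∫⁻ t, (if 0 < y then
        ENNReal.ofReal (Real.exp (-(γ * y))) *
          upstreamIntegral ν η γ n (fun t' => f (junction y t t')) 0 else 0) ∂ν) s

theorem upstreamIntegral_succ (γ : ℝ) (n : ℕ) {f : RiverTree → ℝ≥0∞} (hf : Measurable f) :
    upstreamIntegral ν η γ (n + 1) f 0 = ∫⁻ y in Set.Ici 0, ENNReal.ofReal (Real.exp (-(γ * y))) *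
      ∫⁻ t, upstreamIntegral ν η γ n (fun t' => f (junction y t t')) 0 ∂ν := by
  have hm : Measurable fun q : ℝ × RiverTree =>
      upstreamIntegral ν η γ n (fun t' => f (junction (q.1 - 0) q.2 t')) q.1 :=
    measurable_upstreamIntegral ν η γ n (measurable_uncurry_junction hf 0) measurable_fst
  rw [upstreamIntegral_succ_eq ν η γ n hf, lintegral_prod]
  · rw [← setLIntegral_congr Ioi_ae_eq_Ici, ← lintegral_indicator measurableSet_Ioi]
    refine lintegral_congr fun y => ?_
    by_cases hy : 0 < y
    · simp only [Set.indicator, Set.mem_Ioi, hy, if_true]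
      rw [← lintegral_const_mul' _ _ ENNReal.ofReal_ne_top]
      refine lintegral_congr fun t => ?_
      rw [upstreamIntegral_eq_zero ν η γ n
        (measurable_comp_junction hf _ _)]
      simp
    · simp [hy]
  · exact (Measurable.ite (measurableSet_lt measurable_const measurable_fst)
      (Measurable.mul (by fun_prop) hm) measurable_const).aemeasurable

theorem upstreamIntegral_zero (γ : ℝ) (f : RiverTree → ℝ≥0∞) :
    upstreamIntegral ν η γ 0 f 0 = ∫⁻ y in Set.Ici 0, ENNReal.ofReal (Real.exp (-(γ * y))) *
      ∫⁻ p, f (junction y p.1 p.2) ∂(η.prod η) := by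
  rw [← lintegral_indicator measurableSet_Ici]
  refine lintegral_congr fun y => ?_
  simp [Set.indicator, streamIntegral_zero]

end RiverTree

/-! ### Decomposition of the attachment law at the first junction -/

namespace RiverTree

open Classical in
/-- The points of a list of `n` points (an arbitrary tuple for a list of another length). -/
noncomputable def pointsOfCard (n : ℕ) (x : Σ n : ℕ, Fin n → ℝ × RiverTree) :
    Fin n → ℝ × RiverTree :=
  if h : x.1 = n then h ▸ x.2 else fun _ => (0, source 0)

theorem measurable_of_sigma {α β : Type*} {X : α → Type*} [∀ a, MeasurableSpace (X a)]
    [MeasurableSpace β] {f : (Σ a, X a) → β} (h : ∀ a, Measurable fun x : X a => f ⟨a, x⟩) :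
    Measurable f := fun _ hS =>
  MeasurableSpace.measurableSet_iInf.2 fun a => h a hS

theorem measurable_sigmaMk {α : Type*} {X : α → Type*} [∀ a, MeasurableSpace (X a)] (a : α) :
    Measurable (Sigma.mk a : X a → Σ a, X a) := fun _ hS =>
  MeasurableSpace.measurableSet_iInf.1 hS a

theorem measurable_pointsOfCard (n : ℕ) : Measurable (pointsOfCard n) := by
  refine measurable_of_sigma fun m => ?_
  by_cases h : m = n
  · subst h
    simpa [pointsOfCard] using measurable_id'
  · simp [pointsOfCard, h]

/-- The space of point lists is cut into the countably many events of a fixed number of points; on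
each of them `pointsOfCard` reduces the claim to tuples. -/
theorem measurable_assemble_sigma (ℓ : ℝ) :
    Measurable fun p : (Σ n : ℕ, Fin n → ℝ × RiverTree) × RiverTree × RiverTree =>
      assemble ℓ p.2.1 p.2.2 0 (List.ofFn p.1.2) := by
  intro S hS
  have h1 : ∀ n : ℕ, MeasurableSet
      {p : (Σ n : ℕ, Fin n → ℝ × RiverTree) × RiverTree × RiverTree | p.1.1 = n} := fun n =>
    (measurable_of_sigma (f := Sigma.fst) fun _ => measurable_const).comp measurable_fst
      (measurableSet_singleton n)
  have h2 := fun n => measurable_assemble n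
    (X := (Σ n : ℕ, Fin n → ℝ × RiverTree) × RiverTree × RiverTree) (ℓ := fun _ => ℓ)
    (s := fun _ => 0) measurable_const measurable_snd.fst measurable_snd.snd measurable_const
    ((measurable_pointsOfCard n).comp measurable_fst)
  convert MeasurableSet.iUnion fun n => (h1 n).inter (h2 n hS) using 1
  ext ⟨⟨m, x⟩, p⟩
  simp only [Set.mem_preimage, Set.mem_iUnion, Set.mem_inter_iff, Set.mem_ofPred_eq,
    Function.comp_apply]
  constructor
  · intro h
    exact ⟨m, rfl, by simpa [pointsOfCard] using h⟩
  · rintro ⟨n, rfl, h⟩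
    simpa [pointsOfCard] using h

theorem measurableSet_strictMono_fst (n : ℕ) :
    MeasurableSet {x : Fin n → ℝ × RiverTree | StrictMono fun i => (x i).1} := by
  have h : {x : Fin n → ℝ × RiverTree | StrictMono fun i => (x i).1} =
      ⋂ i, ⋂ j, ⋂ _ : i < j, {x | (x i).1 < (x j).1} := by
    ext z
    simp [StrictMono]
  rw [h]
  exact MeasurableSet.iInter fun i => MeasurableSet.iInter fun j => MeasurableSet.iInter fun _ =>
    measurableSet_lt (measurable_pi_apply i).fst (measurable_pi_apply j).fst

variable (ν η : Measure RiverTree) [IsFiniteMeasure ν] [IsFiniteMeasure η]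

theorem lintegral_attachLaw {f : RiverTree → ℝ≥0∞} (hf : Measurable f) (ℓ : ℝ) :
    ∫⁻ t, f t ∂(attachLaw ν η ℓ) =
      ENNReal.ofReal (Real.exp (-(ENNReal.ofReal ℓ * ν Set.univ).toReal)) *
        ∑' n : ℕ, streamIntegral ν η n f 0 ℓ := by
  classical
  have hm := hf.comp (measurable_assemble_sigma ℓ)
  have hsf : SFinite (poissonLaw ((volume.restrict (Set.Ioc 0 ℓ)).prod ν)) := by
    unfold poissonLaw
    infer_instance
  rw [attachLaw, lintegral_map hf (measurable_assemble_sigma ℓ)]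
  refine (lintegral_prod _ hm.aemeasurable).trans ?_
  have hm' : Measurable fun x : (Σ n : ℕ, Fin n → ℝ × RiverTree) =>
      ∫⁻ p, f (assemble ℓ p.1 p.2 0 (List.ofFn x.2)) ∂(η.prod η) := hm.lintegral_prod_right'
  rw [poissonLaw, lintegral_smul_measure, lintegral_sum_measure, smul_eq_mul]
  congr 1
  · simp [Measure.prod_apply, lintegral_const, mul_comm]
  · refine tsum_congr fun n => ?_
    have hS : MeasurableSet {x : Fin n → ℝ × RiverTree | IsAttachment 0 ℓ x} :=
      measurableSet_isAttachment measurable_const measurable_const measurable_id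
    refine (lintegral_map hm' (measurable_sigmaMk n)).trans ?_
    have hμ : (volume.restrict (Set.Ioc 0 ℓ)).prod ν =
        ((volume : Measure ℝ).prod ν).restrict (Set.Ioc 0 ℓ ×ˢ Set.univ) := by
      rw [← Measure.prod_restrict, Measure.restrict_univ]
    rw [hμ, ← Measure.restrict_pi_pi, Measure.restrict_restrict (measurableSet_strictMono_fst n),
      streamIntegral]
    -- Confining every point to (0, ℓ] and ordering the points is exactly `IsAttachment 0 ℓ`.
    have hSet : {x : Fin n → ℝ × RiverTree | StrictMono fun i => (x i).1} ∩
        (Set.univ.pi fun _ => Set.Ioc 0 ℓ ×ˢ Set.univ) = {x | IsAttachment 0 ℓ x} := by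
      ext x
      simp [IsAttachment, and_comm]
    rw [hSet, ← lintegral_indicator hS]
    rfl

theorem measurable_attachLaw : Measurable (attachLaw ν η) := by
  refine Measure.measurable_of_measurable_coe _ fun S hS => ?_
  have h : (fun ℓ => attachLaw ν η ℓ S) = fun ℓ =>
      ENNReal.ofReal (Real.exp (-(ENNReal.ofReal ℓ * ν Set.univ).toReal)) *
        ∑' n : ℕ, streamIntegral ν η n (S.indicator 1) 0 ℓ := by
    funext ℓ
    rw [← lintegral_attachLaw ν η (measurable_one.indicator hS), lintegral_indicator_one hS]
  rw [h]
  refine Measurable.mul (by fun_prop) (Measurable.tsum fun n => ?_)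
  exact measurable_streamIntegral ν η n (F := fun _ => S.indicator 1)
    ((measurable_one.indicator hS).comp measurable_snd) measurable_const measurable_id

end RiverTree

theorem lintegral_expMeasure {r : ℝ} {f : ℝ → ℝ≥0∞} (hf : Measurable f) :
    ∫⁻ x, f x ∂(expMeasure r) =
      ∫⁻ x in Set.Ici 0, ENNReal.ofReal (r * Real.exp (-(r * x))) * f x := by
  have hp : Measurable (gammaPDF 1 r) := (measurable_gammaPDFReal 1 r).ennreal_ofReal
  rw [expMeasure, gammaMeasure, lintegral_withDensity_eq_lintegral_mul _ hp hf, ← lintegral_indicator measurableSet_Ici]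
  refine lintegral_congr fun x => ?_
  by_cases hx : 0 ≤ x <;> simp [gammaPDF, gammaPDFReal, hx]

namespace RiverTree

variable (ν η : Measure RiverTree) [IsFiniteMeasure ν] [IsFiniteMeasure η]

/-- The density r exp(-rℓ) of the stream length and the Poisson normalization exp(-ℓ ν(univ))
combine into one exponential weight, whose rate is that of the first event: the end of the stream or
a side tree. -/
theorem lintegral_bind_attachLaw {r : ℝ} (hr : 0 < r) {f : RiverTree → ℝ≥0∞}
    (hf : Measurable f) :
    ∫⁻ t, f t ∂((expMeasure r).bind (attachLaw ν η)) =
      ∑' n : ℕ, ENNReal.ofReal r * upstreamIntegral ν η (r + (ν Set.univ).toReal) n f 0 := by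
  have hs : ∀ n, Measurable fun ℓ => streamIntegral ν η n f 0 ℓ := fun n =>
    measurable_streamIntegral ν η n (F := fun _ : ℝ => f)
      (hf.comp measurable_snd) measurable_const measurable_id
  have hm : Measurable fun ℓ => ∫⁻ t, f t ∂(attachLaw ν η ℓ) :=
    (Measure.measurable_lintegral hf).comp (measurable_attachLaw ν η)
  rw [Measure.lintegral_bind (measurable_attachLaw ν η).aemeasurable hf.aemeasurable,
    lintegral_expMeasure hm]
  have h : ∀ ℓ ∈ Set.Ici (0 : ℝ),
      ENNReal.ofReal (r * Real.exp (-(r * ℓ))) * ∫⁻ t, f t ∂(attachLaw ν η ℓ) =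
        ∑' n : ℕ, ENNReal.ofReal r *
          (ENNReal.ofReal (Real.exp (-((r + (ν Set.univ).toReal) * ℓ))) *
            streamIntegral ν η n f 0 ℓ) := by
    intro ℓ hℓ
    rw [lintegral_attachLaw ν η hf, ENNReal.tsum_mul_left, ENNReal.tsum_mul_left,
      ENNReal.ofReal_mul hr.le, ← mul_assoc, mul_assoc (ENNReal.ofReal r),
      ← ENNReal.ofReal_mul (Real.exp_pos _).le, ← Real.exp_add, ENNReal.toReal_mul,
      ENNReal.toReal_ofReal hℓ, mul_assoc]
    congr 4
    ring
  rw [setLIntegral_congr_fun measurableSet_Ici h, lintegral_tsum]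
  · refine tsum_congr fun n => ?_
    rw [lintegral_const_mul' _ _ ENNReal.ofReal_ne_top, upstreamIntegral,
      ← lintegral_indicator measurableSet_Ici]
    congr 1
    refine lintegral_congr fun ℓ => ?_
    simp [Set.indicator]
  · intro n
    have := hs n
    exact Measurable.aemeasurable (by fun_prop)

/-- The decomposition of a tree at the upper end of its outlet link. -/
theorem lintegral_bind_attachLaw_eq {r : ℝ} (hr : 0 < r) {f : RiverTree → ℝ≥0∞}
    (hf : Measurable f) :
    ∫⁻ t, f t ∂((expMeasure r).bind (attachLaw ν η)) =
      ∫⁻ x in Set.Ici 0, ENNReal.ofReal (Real.exp (-((r + (ν Set.univ).toReal) * x))) *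
        (ENNReal.ofReal r * ∫⁻ p, f (junction x p.1 p.2) ∂(η.prod η) +
          ∫⁻ t, ∫⁻ t', f (junction x t t') ∂((expMeasure r).bind (attachLaw ν η)) ∂ν) := by
  set γ := r + (ν Set.univ).toReal with hγ
  have hU : ∀ n, Measurable fun q : ℝ × RiverTree =>
      upstreamIntegral ν η γ n (fun t' => f (junction q.1 q.2 t')) 0 := fun n =>
    measurable_upstreamIntegral ν η γ n
      (F := fun (q : ℝ × RiverTree) t' => f (junction q.1 q.2 t'))
      (hf.comp (measurable_fst.fst.riverJunction measurable_fst.snd measurable_snd))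
      measurable_const
  have hU' : ∀ n x, Measurable fun t =>
      upstreamIntegral ν η γ n (fun t' => f (junction x t t')) 0 := fun n x =>
    (hU n).comp (measurable_const.prodMk measurable_id)
  have hV : ∀ n, Measurable fun x => ∫⁻ t,
      upstreamIntegral ν η γ n (fun t' => f (junction x t t')) 0 ∂ν := fun n =>
    (hU n).lintegral_prod_right'
  have hfun : Measurable fun w : ℝ × RiverTree × RiverTree => f (junction w.1 w.2.1 w.2.2) :=
    hf.comp measurable_junction
  have h0 : Measurable fun x => ∫⁻ p, f (junction x p.1 p.2) ∂(η.prod η) :=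
    hfun.lintegral_prod_right'
  -- The term `n = 0` is an outlet link that ends at the upstream end of the stream. In the terms `n
  -- + 1` the lowest tree is split off, and the sum over `n` of what remains is again the law of the
  -- tree.
  rw [lintegral_bind_attachLaw ν η hr hf, ENNReal.tsum_mul_left,
    tsum_eq_zero_add' ENNReal.summable]
  simp only [← hγ]
  simp_rw [upstreamIntegral_succ ν η γ _ hf]
  rw [upstreamIntegral_zero, ← lintegral_tsum fun n => ?_]
  · rw [← lintegral_add_left (by fun_prop), ← lintegral_const_mul' _ _ ENNReal.ofReal_ne_top]
    refine lintegral_congr fun x => ?_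
    rw [ENNReal.tsum_mul_left, ← mul_add, ← lintegral_tsum fun n => (hU' n x).aemeasurable,
      mul_left_comm, mul_add]
    congr 2
    rw [← lintegral_const_mul' _ _ ENNReal.ofReal_ne_top]
    refine lintegral_congr fun t => ?_
    rw [lintegral_bind_attachLaw ν η hr (measurable_comp_junction hf x t), ENNReal.tsum_mul_left]
  · have := hV n
    exact Measurable.aemeasurable (by fun_prop)

/-- The number of attached trees is geometric: with E = 1/γ, exactly n trees are attached with
probability r E (E ν(univ))^n, and r E + E ν(univ) = 1. -/
theorem isProbabilityMeasure_bind_attachLaw {r : ℝ} (hr : 0 < r) [IsProbabilityMeasure η] :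
    IsProbabilityMeasure ((expMeasure r).bind (attachLaw ν η)) := by
  set γ := r + (ν Set.univ).toReal with hγ
  have hγ0 : 0 < γ := by positivity
  set E : ℝ≥0∞ := ∫⁻ y in Set.Ici (0 : ℝ), ENNReal.ofReal (Real.exp (-(γ * y))) with hE
  have hγE : ENNReal.ofReal γ * E = 1 := by
    have := isProbabilityMeasure_expMeasure hγ0
    have h := lintegral_expMeasure (r := γ) (measurable_const (a := (1 : ℝ≥0∞)))
    rw [lintegral_const, measure_univ] at h
    rw [hE, ← lintegral_const_mul' _ _ ENNReal.ofReal_ne_top]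
    simpa [ENNReal.ofReal_mul hγ0.le] using h.symm
  have hU : ∀ n, upstreamIntegral ν η γ n (fun _ => 1) 0 = E * (E * ν Set.univ) ^ n := by
    intro n
    induction n with
    | zero => simp [upstreamIntegral_zero, hE]
    | succ n ih =>
      rw [upstreamIntegral_succ ν η γ n measurable_const]
      simp only [ih, lintegral_const]
      rw [lintegral_mul_const _ (by fun_prop), ← hE]
      ring
  constructor
  rw [← lintegral_one, lintegral_bind_attachLaw ν η hr measurable_const]
  simp only [← hγ, hU]
  rw [ENNReal.tsum_mul_left, ENNReal.tsum_mul_left, ENNReal.tsum_geometric, ← mul_assoc]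
  have hab : ENNReal.ofReal r * E + E * ν Set.univ = 1 := by
    rw [← hγE, hγ, ENNReal.ofReal_add hr.le ENNReal.toReal_nonneg,
      ENNReal.ofReal_toReal (measure_ne_top _ _)]
    ring
  have ha : 1 - E * ν Set.univ = ENNReal.ofReal r * E := by
    rw [← hab]
    refine ENNReal.add_sub_cancel_right (ne_top_of_le_ne_top ENNReal.one_ne_top ?_)
    rw [← hab]
    exact le_add_self
  rw [ha]
  refine ENNReal.mul_inv_cancel ?_ (ne_top_of_le_ne_top ENNReal.one_ne_top ?_)
  · refine mul_ne_zero (ENNReal.ofReal_pos.2 hr).ne' fun h => ?_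
    simp [h] at hγE
  · rw [← hab]
    exact le_self_add

end RiverTree

/-! ### The trees of given order in the critical Tokunaga model -/

namespace RiverTree

/-- All links have positive lengths. -/
def Positive : RiverTree → Prop
  | source x => 0 < x
  | junction x t₁ t₂ => 0 < x ∧ t₁.Positive ∧ t₂.Positive

theorem measurable_positive : Measurable Positive := by
  refine measurable_of_rec (φ := fun x => 0 < x) (ψ := fun q => 0 < q.1 ∧ q.2.1 ∧ q.2.2) ?_ ?_
    (fun _ => rfl) (fun _ _ _ => rfl)
  · exact measurableSet_setOfPred.1 measurableSet_Ioi
  · have h : Measurable fun q : ℝ × Prop × Prop => 0 < q.1 :=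
      measurableSet_setOfPred.1 (measurableSet_lt measurable_const measurable_fst)
    exact h.and (measurable_snd.fst.and measurable_snd.snd)

/-- The tree has order `K` and its links have positive lengths. -/
def IsRegular (K : ℕ) (t : RiverTree) : Prop := t.ord = K ∧ t.Positive

theorem measurableSet_isRegular (K : ℕ) : MeasurableSet {t | IsRegular K t} :=
  (measurable_ord (measurableSet_singleton K)).inter (measurableSet_setOfPred.2 measurable_positive)

theorem IsRegular.junction_end {K : ℕ} {x : ℝ} {a b : RiverTree} (hx : 0 < x)
    (ha : IsRegular K a) (hb : IsRegular K b) : IsRegular (K + 1) (junction x a b) :=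
  ⟨by simp [ord, ha.1, hb.1], hx, ha.2, hb.2⟩

theorem IsRegular.junction_side {i K : ℕ} {x : ℝ} {a b : RiverTree} (hx : 0 < x) (hi : i < K)
    (ha : IsRegular i a) (hb : IsRegular K b) : IsRegular K (junction x a b) :=
  ⟨by simp [ord, ha.1, hb.1, hi.ne, hi.le], hx, ha.2, hb.2⟩

end RiverTree

open RiverTree

/-- The law of the tree of order `K` in the critical Tokunaga model. -/
noncomputable def criticalTree (c γ : ℝ) : ℕ → Measure RiverTree :=
  ramTree (tokunagaSeq c) (fun j => γ * c ^ (1 - (j : ℤ)))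

theorem ramTree_tokunagaSeq (c γ : ℝ) (K : ℕ) :
    ramTree (tokunagaSeq c) (fun j => γ * c ^ (1 - (j : ℤ))) K = criticalTree c γ K :=
  rfl

theorem tokunagaSeq_nonneg {c : ℝ} (hc : 1 < c) (k : ℕ) : 0 ≤ tokunagaSeq c k :=
  mul_nonneg (sub_nonneg.2 hc.le) (pow_nonneg (zero_le_one.trans hc.le) _)

theorem tokunagaSeq_succ_succ (c : ℝ) (k : ℕ) :
    tokunagaSeq c (k + 2) = c * tokunagaSeq c (k + 1) := by
  simp [tokunagaSeq, pow_succ]; ring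

theorem tokunagaSeq_one (c : ℝ) : tokunagaSeq c 1 = c - 1 := by simp [tokunagaSeq]

/-- Since T_(k+1) = c T_k, a convolution with the Tokunaga sequence obeys a one-step recursion. All
sums against T below are evaluated in this way. -/
theorem sum_tokunagaSeq_mul_succ (c : ℝ) (u : ℕ → ℝ) (K : ℕ) :
    ∑ i ∈ Finset.range (K + 1), tokunagaSeq c (K + 1 - i) * u i =
      c * ∑ i ∈ Finset.range K, tokunagaSeq c (K - i) * u i + (c - 1) * u K := by
  rw [Finset.sum_range_succ, Finset.mul_sum]
  congr 1
  · refine Finset.sum_congr rfl fun i hi => ?_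
    obtain ⟨k, rfl⟩ := Nat.exists_eq_add_of_lt (Finset.mem_range.1 hi)
    rw [show i + k + 1 + 1 - i = k + 2 by omega, show i + k + 1 - i = k + 1 by omega,
      tokunagaSeq_succ_succ, mul_assoc]
  · simp [tokunagaSeq_one]

/-- With one added, this is the mean number c^K of links in a stream of order K + 1. -/
theorem sum_tokunagaSeq (c : ℝ) (K : ℕ) :
    ∑ i ∈ Finset.range K, tokunagaSeq c (K - i) = c ^ K - 1 := by
  induction K with
  | zero => simp
  | succ K ih =>
    have h := sum_tokunagaSeq_mul_succ c (fun _ => 1) K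
    simp only [mul_one] at h
    rw [h, ih]
    ring

section

variable {c γ : ℝ}

theorem criticalTree_one : criticalTree c γ 1 = (expMeasure γ).map source := by
  simp [criticalTree, ramTree]

/-- The measure by which trees are attached to a stream of order `K + 2`. -/
noncomputable def sideMeasure (c γ : ℝ) (K : ℕ) : Measure RiverTree :=
  ∑ i : Fin (K + 1), ENNReal.ofReal (γ * (c ^ (K + 1))⁻¹ * tokunagaSeq c (K + 1 - i)) •
    criticalTree c γ (i + 1)

theorem criticalTree_add_two (K : ℕ) : criticalTree c γ (K + 2) =
    (expMeasure (γ * (c ^ (K + 1))⁻¹)).bind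
      (attachLaw (sideMeasure c γ K) (criticalTree c γ (K + 1))) := by
  have h : c ^ (1 - ((K + 2 : ℕ) : ℤ)) = (c ^ (K + 1))⁻¹ := by
    rw [show (1 - ((K + 2 : ℕ) : ℤ)) = -((K + 1 : ℕ) : ℤ) by push_cast; ring, zpow_neg,
      zpow_natCast]
  rw [criticalTree, ramTree, ← criticalTree]
  simp only [h]
  congr 2
  refine Finset.sum_congr rfl fun i _ => ?_
  congr 4
  omega

theorem isProbabilityMeasure_criticalTree_aux (hc : 1 < c) (hγ : 0 < γ) (K : ℕ) :
    IsProbabilityMeasure (criticalTree c γ (K + 1)) := by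
  induction K using Nat.strong_induction_on with
  | _ K ih =>
    cases K with
    | zero =>
      have := isProbabilityMeasure_expMeasure hγ
      rw [criticalTree_one]
      exact Measure.isProbabilityMeasure_map measurable_source.aemeasurable
    | succ K =>
      have := ih K (Nat.lt_succ_self K)
      have : IsFiniteMeasure (sideMeasure c γ K) := by
        unfold sideMeasure
        have : ∀ i : Fin (K + 1), IsFiniteMeasure (ENNReal.ofReal
            (γ * (c ^ (K + 1))⁻¹ * tokunagaSeq c (K + 1 - i)) • criticalTree c γ (i + 1)) :=
          fun i => by
            have := ih i i.2
            exact Measure.smul_finite _ ENNReal.ofReal_ne_top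
        infer_instance
      rw [criticalTree_add_two]
      exact isProbabilityMeasure_bind_attachLaw _ _ (by positivity)

instance isProbabilityMeasure_criticalTree [hc : Fact (1 < c)] [hγ : Fact (0 < γ)] (K : ℕ) :
    IsProbabilityMeasure (criticalTree c γ (K + 1)) :=
  isProbabilityMeasure_criticalTree_aux hc.out hγ.out K

theorem isProbabilityMeasure_expMeasure_of_fact [hγ : Fact (0 < γ)] :
    IsProbabilityMeasure (expMeasure γ) :=
  isProbabilityMeasure_expMeasure hγ.out

set_option linter.unusedSectionVars false

attribute [local instance] isProbabilityMeasure_expMeasure_of_fact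

variable [hc : Fact (1 < c)] [hγ : Fact (0 < γ)]

instance isFiniteMeasure_sideMeasure (K : ℕ) : IsFiniteMeasure (sideMeasure c γ K) := by
  unfold sideMeasure
  have : ∀ i : Fin (K + 1), IsFiniteMeasure (ENNReal.ofReal
      (γ * (c ^ (K + 1))⁻¹ * tokunagaSeq c (K + 1 - i)) • criticalTree c γ (i + 1)) :=
    fun i => Measure.smul_finite _ ENNReal.ofReal_ne_top
  infer_instance

/-- The probability that a link of a stream of order `K + 1` is the last link of this stream. -/
noncomputable def endProb (c : ℝ) (K : ℕ) : ℝ≥0∞ := ENNReal.ofReal (c ^ K)⁻¹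

/-- The mean number of trees attached to a stream of order `K + 1`. -/
noncomputable def sideMean (c : ℝ) (K : ℕ) : ℝ≥0∞ :=
  ∑ i ∈ Finset.range K, ENNReal.ofReal (tokunagaSeq c (K - i))

theorem sum_ofReal_tokunagaSeq (c : ℝ) (K : ℕ) :
    ∑ i ∈ Finset.range K, ENNReal.ofReal (tokunagaSeq c (K - i)) = sideMean c K :=
  rfl

theorem one_add_sideMean (K : ℕ) : 1 + sideMean c K = ENNReal.ofReal (c ^ K) := by
  rw [sideMean, ← ENNReal.ofReal_sum_of_nonneg fun i _ => tokunagaSeq_nonneg hc.out _,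
    sum_tokunagaSeq, ← ENNReal.ofReal_one, ← ENNReal.ofReal_add zero_le_one
      (sub_nonneg.2 (one_le_pow₀ hc.out.le))]
  ring_nf

theorem ofReal_pow_mul_endProb (K : ℕ) : ENNReal.ofReal (c ^ K) * endProb c K = 1 := by
  have h : 0 < c ^ K := pow_pos (zero_lt_one.trans hc.out) K
  rw [endProb, ← ENNReal.ofReal_mul h.le, mul_inv_cancel₀ h.ne', ENNReal.ofReal_one]

theorem endProb_mul_add (K : ℕ) : endProb c K + endProb c K * sideMean c K = 1 := by
  rw [← ofReal_pow_mul_endProb (c := c) K, ← one_add_sideMean]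
  ring

/-- Criticality: the rate at which a stream ends and the total rate of its side trees add up to γ,
whatever the order. All links therefore have the same law. -/
theorem sideMeasure_univ (K : ℕ) : γ * (c ^ (K + 1))⁻¹ + (sideMeasure c γ K Set.univ).toReal = γ := by
  have hc0 : 0 < c := zero_lt_one.trans hc.out
  have hr : 0 ≤ γ * (c ^ (K + 1))⁻¹ := by have := hγ.out; positivity
  have h : sideMeasure c γ K Set.univ =
      ENNReal.ofReal (γ * (c ^ (K + 1))⁻¹ * (c ^ (K + 1) - 1)) := by
    rw [← sum_tokunagaSeq, Finset.sum_range, Finset.mul_sum, ENNReal.ofReal_sum_of_nonneg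
      fun i _ => mul_nonneg hr (tokunagaSeq_nonneg hc.out _)]
    simp [sideMeasure]
  rw [h, ENNReal.toReal_ofReal (mul_nonneg hr (sub_nonneg.2 (one_le_pow₀ hc.out.le)))]
  field_simp
  ring

theorem lintegral_sideMeasure (K : ℕ) (f : RiverTree → ℝ≥0∞) : ∫⁻ t, f t ∂(sideMeasure c γ K) =
    ENNReal.ofReal γ * (endProb c (K + 1) * ∑ i ∈ Finset.range (K + 1),
      ENNReal.ofReal (tokunagaSeq c (K + 1 - i)) * ∫⁻ t, f t ∂(criticalTree c γ (i + 1))) := by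
  have hc0 : 0 < c := zero_lt_one.trans hc.out
  have hγ0 := hγ.out
  rw [sideMeasure, lintegral_finsetSum_measure, Finset.sum_range, Finset.mul_sum, Finset.mul_sum]
  refine Finset.sum_congr rfl fun i _ => ?_
  rw [lintegral_smul_measure, ENNReal.ofReal_mul (by positivity), ENNReal.ofReal_mul hγ0.le,
    endProb, smul_eq_mul]
  ring

/-- The decomposition of a tree of the critical Tokunaga model at the upper end of its outlet
link: the outlet link is followed by two trees of the next lower order, or by a tree attached to
the root stream and the remaining tree. -/
theorem lintegral_criticalTree_add_two (K : ℕ) {f : RiverTree → ℝ≥0∞} (hf : Measurable f) :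
    ∫⁻ t, f t ∂(criticalTree c γ (K + 2)) = ∫⁻ x, endProb c (K + 1) *
      (∫⁻ p, f (junction x p.1 p.2)
          ∂((criticalTree c γ (K + 1)).prod (criticalTree c γ (K + 1))) +
        ∑ i ∈ Finset.range (K + 1), ENNReal.ofReal (tokunagaSeq c (K + 1 - i)) *
          ∫⁻ t, ∫⁻ t', f (junction x t t') ∂(criticalTree c γ (K + 2))
            ∂(criticalTree c γ (i + 1))) ∂(expMeasure γ) := by
  have hc0 : 0 < c := zero_lt_one.trans hc.out
  have hγ0 := hγ.out
  have hfun : Measurable fun w : ℝ × RiverTree × RiverTree => f (junction w.1 w.2.1 w.2.2) :=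
    hf.comp measurable_junction
  have h0 : Measurable fun x => ∫⁻ p, f (junction x p.1 p.2)
      ∂((criticalTree c γ (K + 1)).prod (criticalTree c γ (K + 1))) := hfun.lintegral_prod_right'
  have h1 : ∀ i, Measurable fun x => ∫⁻ t, ∫⁻ t', f (junction x t t') ∂(criticalTree c γ (K + 2))
      ∂(criticalTree c γ (i + 1)) := fun i => by
    refine Measurable.lintegral_prod_right' (f := fun q : ℝ × RiverTree =>
      ∫⁻ t', f (junction q.1 q.2 t') ∂(criticalTree c γ (K + 2))) ?_
    refine Measurable.lintegral_prod_right' (f := fun w : (ℝ × RiverTree) × RiverTree =>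
      f (junction w.1.1 w.1.2 w.2)) ?_
    exact hf.comp (measurable_fst.fst.riverJunction measurable_fst.snd measurable_snd)
  have hr : 0 < γ * (c ^ (K + 1))⁻¹ := by positivity
  rw [lintegral_expMeasure (by fun_prop)]
  conv_lhs => rw [criticalTree_add_two, lintegral_bind_attachLaw_eq _ _ hr hf, sideMeasure_univ]
  refine lintegral_congr fun x => ?_
  rw [lintegral_sideMeasure, ← criticalTree_add_two, ENNReal.ofReal_mul hγ0.le,
    ENNReal.ofReal_mul hγ0.le, ← endProb]
  ring

theorem ae_expMeasure_pos : ∀ᵐ x ∂(expMeasure γ), 0 < x := by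
  rw [ae_iff]
  change expMeasure γ (Set.Ioi 0)ᶜ = 0
  rw [← lintegral_indicator_one (measurableSet_Ioi (a := (0 : ℝ))).compl,
    lintegral_expMeasure (measurable_one.indicator measurableSet_Ioi.compl),
    ← setLIntegral_congr Ioi_ae_eq_Ici]
  refine (setLIntegral_congr_fun measurableSet_Ioi fun x hx => ?_).trans lintegral_zero
  simp only [Set.mem_Ioi] at hx
  simp [hx]

/-- The product of `endProb` and `sideMean` is the probability of a side junction, which is below 1.
Finiteness of `u` is needed because `u` is cancelled. -/
theorem eq_zero_of_le_endProb_mul {K : ℕ} {u : ℝ≥0∞} (hu : u ≠ ∞)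
    (h : u ≤ endProb c K * (sideMean c K * u)) : u = 0 := by
  have h1 : endProb c K * u + u ≤ 0 + u := by
    calc endProb c K * u + u ≤ endProb c K * u + endProb c K * (sideMean c K * u) := by gcongr
      _ = (endProb c K + endProb c K * sideMean c K) * u := by ring
      _ = 0 + u := by rw [endProb_mul_add, one_mul, zero_add]
  have h2 := ENNReal.le_of_add_le_add_right hu h1
  have h3 : endProb c K ≠ 0 := fun h0 => by
    simpa [h0] using ofReal_pow_mul_endProb (c := c) K
  simpa [h3] using h2

end

/-! ### Regularity of the trees, and functionals additive along the root stream -/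

section

attribute [local instance] isProbabilityMeasure_expMeasure_of_fact

variable {c γ : ℝ} [hc : Fact (1 < c)] [hγ : Fact (0 < γ)]

theorem ae_prod_of_ae {α : Type*} [MeasurableSpace α] {μ : Measure α} [SFinite μ] {p : α → Prop}
    (h : ∀ᵐ t ∂μ, p t) : ∀ᵐ q ∂(μ.prod μ), p q.1 ∧ p q.2 :=
  (Measure.quasiMeasurePreserving_fst.ae h).and (Measure.quasiMeasurePreserving_snd.ae h)

/-- By induction the lower-order trees at the first junction are almost surely regular, so
irregularity can only come from the remainder, which has the law of the whole tree. The probability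
u of irregularity thus satisfies u ≤ ρ u with ρ < 1, and u = 0. -/
theorem ae_isRegular (K : ℕ) : ∀ᵐ t ∂(criticalTree c γ (K + 1)), IsRegular (K + 1) t := by
  induction K using Nat.strong_induction_on with
  | _ K ih =>
    cases K with
    | zero =>
      rw [zero_add, criticalTree_one, ae_map_iff measurable_source.aemeasurable
        (measurableSet_isRegular 1)]
      filter_upwards [ae_expMeasure_pos] with x hx
      exact ⟨rfl, hx⟩
    | succ K =>
      have hS := (measurableSet_isRegular (K + 2)).compl
      set f : RiverTree → ℝ≥0∞ := {t | IsRegular (K + 2) t}ᶜ.indicator 1 with hf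
      have hfm : Measurable f := measurable_one.indicator hS
      have hle : ∫⁻ t, f t ∂(criticalTree c γ (K + 2)) ≤ endProb c (K + 1) *
          (sideMean c (K + 1) * ∫⁻ t, f t ∂(criticalTree c γ (K + 2))) := by
        conv_lhs => rw [lintegral_criticalTree_add_two K hfm]
        calc _ ≤ ∫⁻ x, endProb c (K + 1) * (sideMean c (K + 1) *
              ∫⁻ t, f t ∂(criticalTree c γ (K + 2))) ∂(expMeasure γ) := by
              refine lintegral_mono_ae ?_
              filter_upwards [ae_expMeasure_pos] with x hx
              refine mul_le_mul' le_rfl ?_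
              have h0 : ∫⁻ p, f (junction x p.1 p.2)
                  ∂((criticalTree c γ (K + 1)).prod (criticalTree c γ (K + 1))) = 0 := by
                refine (lintegral_congr_ae ?_).trans lintegral_zero
                filter_upwards [ae_prod_of_ae (ih K (Nat.lt_succ_self K))] with p hp
                simp [hf, IsRegular.junction_end hx hp.1 hp.2]
              rw [h0, zero_add, sideMean, Finset.sum_mul]
              refine Finset.sum_le_sum fun i hi => mul_le_mul' le_rfl ?_
              calc ∫⁻ t, ∫⁻ t', f (junction x t t') ∂(criticalTree c γ (K + 2))
                    ∂(criticalTree c γ (i + 1)) ≤ ∫⁻ _, ∫⁻ t, f t ∂(criticalTree c γ (K + 2))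
                    ∂(criticalTree c γ (i + 1)) := by
                    refine lintegral_mono_ae ?_
                    filter_upwards [ih i (Finset.mem_range.1 hi)] with t ht
                    refine lintegral_mono fun t' => ?_
                    by_cases ht' : IsRegular (K + 2) t'
                    · simp [hf, IsRegular.junction_side hx
                        (Nat.add_lt_add_right (Finset.mem_range.1 hi) 1) ht ht']
                    · simp only [hf]
                      rw [Set.indicator_of_mem (a := t') (by exact ht')]
                      exact Set.indicator_le_self' (fun _ _ => zero_le) _
                _ = _ := by simp
          _ = _ := by simp
      have h := eq_zero_of_le_endProb_mul (ne_top_of_le_ne_top ENNReal.one_ne_top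
        ((lintegral_mono fun t => Set.indicator_le_self' (fun _ _ => zero_le) t).trans_eq
          (by simp))) hle
      rwa [lintegral_indicator_one hS] at h

/-- This evaluates the right-hand side of the first-link decomposition for an additive integrand.
The functional `f` is kept arbitrary so that the formula applies to a functional and to its
truncations. -/
theorem lintegral_root_decomposition (K : ℕ) {f ε : RiverTree → ℝ≥0∞} {β : ℝ → ℝ≥0∞}
    (hε : Measurable ε) (hβ : Measurable β) :
    ∫⁻ x, endProb c (K + 1) * (∫⁻ p, (β x + (ε p.1 + ε p.2))
          ∂((criticalTree c γ (K + 1)).prod (criticalTree c γ (K + 1))) +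
        ∑ i ∈ Finset.range (K + 1), ENNReal.ofReal (tokunagaSeq c (K + 1 - i)) *
          ∫⁻ t, ∫⁻ t', (β x + (ε t + f t')) ∂(criticalTree c γ (K + 2))
            ∂(criticalTree c γ (i + 1))) ∂(expMeasure γ) =
      (∫⁻ x, β x ∂(expMeasure γ) + endProb c (K + 1) *
        (2 * ∫⁻ t, ε t ∂(criticalTree c γ (K + 1)) + ∑ i ∈ Finset.range (K + 1),
          ENNReal.ofReal (tokunagaSeq c (K + 1 - i)) * ∫⁻ t, ε t ∂(criticalTree c γ (i + 1)))) +
        endProb c (K + 1) * (sideMean c (K + 1) * ∫⁻ t, f t ∂(criticalTree c γ (K + 2))) := by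
  have h1 : ∀ x, ∫⁻ p, (β x + (ε p.1 + ε p.2))
      ∂((criticalTree c γ (K + 1)).prod (criticalTree c γ (K + 1))) =
        β x + 2 * ∫⁻ t, ε t ∂(criticalTree c γ (K + 1)) := fun x => by
    rw [lintegral_add_left measurable_const]
    have h := lintegral_add_left (μ := (criticalTree c γ (K + 1)).prod (criticalTree c γ (K + 1)))
      (hε.comp measurable_fst) fun p => ε p.2
    simp only [Function.comp_apply] at h
    rw [h, measurePreserving_fst.lintegral_comp hε, measurePreserving_snd.lintegral_comp hε]
    simp [two_mul]
  have h2 : ∀ x i, ∫⁻ t, ∫⁻ t', (β x + (ε t + f t')) ∂(criticalTree c γ (K + 2))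
      ∂(criticalTree c γ (i + 1)) = (β x + ∫⁻ t, f t ∂(criticalTree c γ (K + 2))) +
        ∫⁻ t, ε t ∂(criticalTree c γ (i + 1)) := fun x i => by
    simp_rw [lintegral_add_left measurable_const]
    rw [lintegral_add_right _ measurable_const]
    simp only [lintegral_const, measure_univ, mul_one]
    ring
  simp_rw [h1, h2, mul_add (ENNReal.ofReal _), Finset.sum_add_distrib, ← Finset.sum_mul,
    sum_ofReal_tokunagaSeq]
  rw [lintegral_const_mul _ (by fun_prop)]
  have h3 : ∀ x, β x + 2 * ∫⁻ t, ε t ∂(criticalTree c γ (K + 1)) +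
      (sideMean c (K + 1) * β x + sideMean c (K + 1) * ∫⁻ t, f t ∂(criticalTree c γ (K + 2)) +
        ∑ i ∈ Finset.range (K + 1), ENNReal.ofReal (tokunagaSeq c (K + 1 - i)) *
          ∫⁻ t, ε t ∂(criticalTree c γ (i + 1))) = (1 + sideMean c (K + 1)) * β x +
      (2 * ∫⁻ t, ε t ∂(criticalTree c γ (K + 1)) +
        sideMean c (K + 1) * ∫⁻ t, f t ∂(criticalTree c γ (K + 2)) +
        ∑ i ∈ Finset.range (K + 1), ENNReal.ofReal (tokunagaSeq c (K + 1 - i)) *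
          ∫⁻ t, ε t ∂(criticalTree c γ (i + 1))) := fun x => by ring
  simp_rw [h3]
  rw [lintegral_add_right _ measurable_const, lintegral_const_mul _ hβ, lintegral_const,
    measure_univ, mul_one, mul_add, ← mul_assoc, mul_add (endProb c (K + 1)) 1, mul_one,
    endProb_mul_add, one_mul]
  ring

/-- The mean of a functional that is a sum over the links of the root stream and over the trees
attached to the root stream. -/
theorem lintegral_criticalTree_of_root_additive (K : ℕ) {f ε : RiverTree → ℝ≥0∞}
    {β : ℝ → ℝ≥0∞} (hf : Measurable f) (hε : Measurable ε) (hβ : Measurable β)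
    (hend : ∀ x a b, 0 < x → IsRegular (K + 1) a → IsRegular (K + 1) b →
      f (junction x a b) = β x + (ε a + ε b))
    (hside : ∀ i x t t', 0 < x → i < K + 1 → IsRegular (i + 1) t → IsRegular (K + 2) t' →
      f (junction x t t') = β x + (ε t + f t')) :
    ∫⁻ t, f t ∂(criticalTree c γ (K + 2)) =
      ENNReal.ofReal (c ^ (K + 1)) * ∫⁻ x, β x ∂(expMeasure γ) +
        (2 * ∫⁻ t, ε t ∂(criticalTree c γ (K + 1)) + ∑ i ∈ Finset.range (K + 1),
          ENNReal.ofReal (tokunagaSeq c (K + 1 - i)) * ∫⁻ t, ε t ∂(criticalTree c γ (i + 1))) := by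
  set S := 2 * ∫⁻ t, ε t ∂(criticalTree c γ (K + 1)) + ∑ i ∈ Finset.range (K + 1),
    ENNReal.ofReal (tokunagaSeq c (K + 1 - i)) * ∫⁻ t, ε t ∂(criticalTree c γ (i + 1)) with hS
  set D := ∫⁻ x, β x ∂(expMeasure γ) + endProb c (K + 1) * S with hD
  -- For a finite mean F, the equation F = D + ρF with 1 - ρ = `endProb` gives `endProb` F = D. As F
  -- may be infinite, the two inequalities are proved separately, the upper bound through
  -- truncations.
  have heq : ∫⁻ t, f t ∂(criticalTree c γ (K + 2)) = D + endProb c (K + 1) *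
      (sideMean c (K + 1) * ∫⁻ t, f t ∂(criticalTree c γ (K + 2))) := by
    rw [← lintegral_root_decomposition K hε hβ]
    conv_lhs => rw [lintegral_criticalTree_add_two K hf]
    refine lintegral_congr_ae ?_
    filter_upwards [ae_expMeasure_pos] with x hx
    congr 2
    · refine lintegral_congr_ae ?_
      filter_upwards [ae_prod_of_ae (ae_isRegular K)] with p hp
      exact hend x _ _ hx hp.1 hp.2
    · refine Finset.sum_congr rfl fun i hi => ?_
      congr 1
      refine lintegral_congr_ae ?_
      filter_upwards [ae_isRegular i] with t ht
      refine lintegral_congr_ae ?_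
      filter_upwards [ae_isRegular (K + 1)] with t' ht'
      exact hside i x t t' hx (Finset.mem_range.1 hi) ht ht'
  have htrunc : ∀ n : ℕ, endProb c (K + 1) * ∫⁻ t, min (f t) n ∂(criticalTree c γ (K + 2)) ≤ D := by
    intro n
    have hfm : Measurable fun t => min (f t) n := hf.min measurable_const
    have hle : ∫⁻ t, min (f t) n ∂(criticalTree c γ (K + 2)) ≤ D + endProb c (K + 1) *
        (sideMean c (K + 1) * ∫⁻ t, min (f t) n ∂(criticalTree c γ (K + 2))) := by
      rw [← lintegral_root_decomposition K hε hβ]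
      conv_lhs => rw [lintegral_criticalTree_add_two K hfm]
      refine lintegral_mono_ae ?_
      filter_upwards [ae_expMeasure_pos] with x hx
      refine mul_le_mul' le_rfl (add_le_add ?_ ?_)
      · refine lintegral_mono_ae ?_
        filter_upwards [ae_prod_of_ae (ae_isRegular K)] with p hp
        exact (min_le_left _ _).trans_eq (hend x _ _ hx hp.1 hp.2)
      · refine Finset.sum_le_sum fun i hi => mul_le_mul' le_rfl ?_
        refine lintegral_mono_ae ?_
        filter_upwards [ae_isRegular i] with t ht
        refine lintegral_mono_ae ?_
        filter_upwards [ae_isRegular (K + 1)] with t' ht'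
        rw [hside i x t t' hx (Finset.mem_range.1 hi) ht ht']
        -- Truncation preserves the inequality: min(β + ε + f', n) ≤ β + ε + min(f', n).
        rcases le_total (f t') n with h | h
        · rw [min_eq_left h]
          exact min_le_left _ _
        · rw [min_eq_right h]
          exact (min_le_right _ _).trans (le_add_self.trans le_add_self)
    have hfin : ∫⁻ t, min (f t) n ∂(criticalTree c γ (K + 2)) ≠ ∞ :=
      ne_top_of_le_ne_top (ENNReal.natCast_ne_top n)
        ((lintegral_mono fun t => min_le_right _ _).trans_eq (by simp))
    have hfin2 : endProb c (K + 1) *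
        (sideMean c (K + 1) * ∫⁻ t, min (f t) n ∂(criticalTree c γ (K + 2))) ≠ ∞ := by
      refine ENNReal.mul_ne_top ENNReal.ofReal_ne_top (ENNReal.mul_ne_top ?_ hfin)
      exact (ENNReal.sum_lt_top.2 fun i _ => ENNReal.ofReal_lt_top).ne
    refine ENNReal.le_of_add_le_add_right hfin2 (le_trans (le_of_eq ?_) hle)
    rw [← mul_assoc, ← add_mul, endProb_mul_add, one_mul]
  have hsup : ∫⁻ t, f t ∂(criticalTree c γ (K + 2)) =
      ⨆ n : ℕ, ∫⁻ t, min (f t) n ∂(criticalTree c γ (K + 2)) := by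
    rw [← lintegral_iSup (fun n => hf.min measurable_const)
      fun m n hmn t => min_le_min_left _ (by exact_mod_cast hmn)]
    refine lintegral_congr fun t => ?_
    rw [← inf_iSup_eq, ENNReal.iSup_natCast, inf_top_eq]
  have hfle : endProb c (K + 1) * ∫⁻ t, f t ∂(criticalTree c γ (K + 2)) ≤ D := by
    rw [hsup, ENNReal.mul_iSup]
    exact iSup_le htrunc
  have hDle : D ≤ endProb c (K + 1) * ∫⁻ t, f t ∂(criticalTree c γ (K + 2)) := by
    -- An infinite mean makes this inequality trivial; otherwise the ρF term can be cancelled.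
    by_cases hfin : ∫⁻ t, f t ∂(criticalTree c γ (K + 2)) = ∞
    · rw [hfin, ENNReal.mul_top]
      · exact le_top
      · intro h0
        simpa [h0] using ofReal_pow_mul_endProb (c := c) (K + 1)
    have hfin2 : endProb c (K + 1) *
        (sideMean c (K + 1) * ∫⁻ t, f t ∂(criticalTree c γ (K + 2))) ≠ ∞ := by
      refine ENNReal.mul_ne_top ENNReal.ofReal_ne_top (ENNReal.mul_ne_top ?_ hfin)
      exact (ENNReal.sum_lt_top.2 fun i _ => ENNReal.ofReal_lt_top).ne
    refine ENNReal.le_of_add_le_add_right hfin2 (heq.symm.trans_le (le_of_eq ?_))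
    rw [← mul_assoc, ← add_mul, endProb_mul_add, one_mul]
  have := congrArg (ENNReal.ofReal (c ^ (K + 1)) * ·) (hfle.antisymm hDle)
  simp only [hD, mul_add, ← mul_assoc, ofReal_pow_mul_endProb, one_mul] at this
  exact this

/-- The mixture components have almost surely distinct orders, so conditioning selects one component
and its weight cancels. -/
theorem givenOrder_criticalTokunagaLaw (K : ℕ) :
    givenOrder (criticalTokunagaLaw c γ) (K + 1) = criticalTree c γ (K + 1) := by
  have hO : MeasurableSet {t : RiverTree | t.ord = K + 1} :=
    measurable_ord (measurableSet_singleton _)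
  have hP : ∀ A, MeasurableSet A → criticalTokunagaLaw c γ ({t | t.ord = K + 1} ∩ A) =
      ENNReal.ofReal (1 / 2 * (1 - 1 / 2) ^ K) * criticalTree c γ (K + 1) A := by
    intro A hA
    rw [criticalTokunagaLaw, selfSimilarRamLaw, ramLaw, Measure.sum_apply _ (hO.inter hA),
      tsum_eq_single K]
    · simp only [Measure.smul_apply, Nat.add_sub_cancel, smul_eq_mul, ramTree_tokunagaSeq]
      congr 1
      refine measure_congr ?_
      filter_upwards [ae_isRegular (c := c) (γ := γ) K] with t ht
      exact propext ⟨fun h => h.2, fun h => ⟨ht.1, h⟩⟩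
    · intro k hk
      simp only [Measure.smul_apply, smul_eq_mul, ramTree_tokunagaSeq]
      refine mul_eq_zero_of_right _ (measure_eq_zero_iff_ae_notMem.2 ?_)
      filter_upwards [ae_isRegular (c := c) (γ := γ) k] with t ht h
      exact hk (by have := ht.1.symm.trans h.1; omega)
  have hw : ENNReal.ofReal (1 / 2 * (1 - 1 / 2) ^ K) ≠ 0 :=
    (ENNReal.ofReal_pos.2 (by positivity)).ne'
  ext A hA
  have hP1 := hP Set.univ MeasurableSet.univ
  rw [Set.inter_univ, measure_univ, mul_one] at hP1
  rw [givenOrder, cond_apply hO, hP A hA, hP1, ← mul_assoc,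
    ENNReal.inv_mul_cancel hw ENNReal.ofReal_ne_top, one_mul]

end

/-! ### Mean numbers of streams, areas, lengths of root streams, numbers of attached trees -/

namespace RiverTree

/-- The sum of `φ` over the lengths of the links that end at a source, and of `ψ` over the lengths
of the other links. -/
noncomputable def linkSum (φ ψ : ℝ → ℝ≥0∞) : RiverTree → ℝ≥0∞
  | source x => φ x
  | junction x t₁ t₂ => ψ x + (t₁.linkSum φ ψ + t₂.linkSum φ ψ)

theorem measurable_linkSum {φ ψ : ℝ → ℝ≥0∞} (hφ : Measurable φ) (hψ : Measurable ψ) :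
    Measurable (linkSum φ ψ) :=
  measurable_of_rec (ψ := fun q => ψ q.1 + (q.2.1 + q.2.2)) hφ (by fun_prop) (fun _ => rfl)
    (fun _ _ _ => rfl)

theorem ord_pos (t : RiverTree) : 0 < t.ord := by
  induction t with
  | source x => simp [ord]
  | junction x a b ha hb =>
    simp only [ord]
    split_ifs
    · omega
    · exact lt_max_of_lt_left ha

theorem streamCount_one_eq_linkSum (t : RiverTree) :
    ((t.streamCount 1 : ℕ) : ℝ≥0∞) = t.linkSum (fun _ => 1) (fun _ => 0) := by
  induction t with
  | source x => simp [streamCount, linkSum]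
  | junction x a b ha hb =>
    have : a.ord ≠ 0 := a.ord_pos.ne'
    simp [streamCount, linkSum, ha, hb, this]

theorem Positive.area_nonneg {g : ℝ → ℝ} (hg : ∀ x, 0 < x → 0 ≤ g x) {t : RiverTree}
    (ht : t.Positive) : 0 ≤ t.area g := by
  induction t with
  | source x => exact hg x ht
  | junction x a b ha hb =>
    exact add_nonneg (hg x ht.1) (add_nonneg (ha ht.2.1) (hb ht.2.2))

theorem Positive.ofReal_area {g : ℝ → ℝ} (hg : ∀ x, 0 < x → 0 ≤ g x) {t : RiverTree}
    (ht : t.Positive) : ENNReal.ofReal (t.area g) =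
      t.linkSum (fun x => ENNReal.ofReal (g x)) (fun x => ENNReal.ofReal (g x)) := by
  induction t with
  | source x => rfl
  | junction x a b ha hb =>
    rw [area, linkSum, ENNReal.ofReal_add (hg x ht.1)
      (add_nonneg (ht.2.1.area_nonneg hg) (ht.2.2.area_nonneg hg)),
      ENNReal.ofReal_add (ht.2.1.area_nonneg hg) (ht.2.2.area_nonneg hg), ha ht.2.1, hb ht.2.2]

theorem Positive.rootStreamLength_nonneg {t : RiverTree} (ht : t.Positive) :
    0 ≤ t.rootStreamLength := by
  induction t with
  | source x => exact le_of_lt ht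
  | junction x a b ha hb =>
    simp only [rootStreamLength]
    have h0 : 0 < x := ht.1
    have h1 := ha ht.2.1
    have h2 := hb ht.2.2
    split_ifs <;> positivity

end RiverTree

theorem integrable_and_integral_eq {α : Type*} [MeasurableSpace α] {μ : Measure α} {f : α → ℝ}
    (hf : Measurable f) (h0 : ∀ᵐ t ∂μ, 0 ≤ f t) {r : ℝ} (hr : 0 ≤ r)
    (h : ∫⁻ t, ENNReal.ofReal (f t) ∂μ = ENNReal.ofReal r) : Integrable f μ ∧ ∫ t, f t ∂μ = r := by
  refine ⟨⟨hf.aestronglyMeasurable, ?_⟩, ?_⟩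
  · rw [hasFiniteIntegral_iff_ofReal h0, h]
    exact ENNReal.ofReal_lt_top
  · rw [integral_eq_lintegral_of_nonneg_ae h0 hf.aestronglyMeasurable, h, ENNReal.toReal_ofReal hr]

/-- The mean number of streams of order `1` in a tree of order `K + 1`. -/
noncomputable def leafMean (c : ℝ) (K : ℕ) : ℝ := (c * (2 * c) ^ K + c - 1) / (2 * c - 1)

theorem leafMean_zero {c : ℝ} (hc : 1 < c) : leafMean c 0 = 1 := by
  rw [leafMean, div_eq_one_iff_eq (by linarith)]
  ring

/-- The source counts satisfy N_(K+1) = 2 N_K + ∑ T_(K+1-i) N_i. Eliminating the sum leaves a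
second-order recursion with characteristic roots 1 and 2c, and this is its first-order form. -/
theorem leafMean_succ {c : ℝ} (hc : 1 < c) (K : ℕ) :
    leafMean c (K + 1) = 2 * c * leafMean c K - (c - 1) := by
  have h : 2 * c - 1 ≠ 0 := by linarith
  have h1 : leafMean c K * (2 * c - 1) = c * (2 * c) ^ K + c - 1 := div_mul_cancel₀ _ h
  refine mul_right_cancel₀ h ?_
  rw [leafMean, div_mul_cancel₀ _ h, sub_mul, mul_assoc, h1]
  ring

theorem one_le_leafMean {c : ℝ} (hc : 1 < c) (K : ℕ) : 1 ≤ leafMean c K := by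
  induction K with
  | zero => exact (leafMean_zero hc).ge
  | succ K ih =>
    rw [leafMean_succ hc]
    nlinarith

theorem leafMean_le {c : ℝ} (hc : 1 < c) (K : ℕ) : leafMean c K ≤ (2 * c) ^ K := by
  induction K with
  | zero => exact (leafMean_zero hc).le
  | succ K ih =>
    rw [leafMean_succ hc, pow_succ]
    nlinarith

/-- A binary tree with N sources has N - 1 other links, so a N + b (N - 1) is the mean total when
sources weigh a and other links b. The identity is its balance over the root stream, which has
c^(K+1) links on average, the two trees at its end and the side trees. -/
theorem sum_tokunagaSeq_mul_leafMean {c : ℝ} (hc : 1 < c) (a b : ℝ) (K : ℕ) :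
    ∑ i ∈ Finset.range (K + 1), tokunagaSeq c (K + 1 - i) *
      (a * leafMean c i + b * (leafMean c i - 1)) =
      (a * leafMean c (K + 1) + b * (leafMean c (K + 1) - 1)) - c ^ (K + 1) * b -
        2 * (a * leafMean c K + b * (leafMean c K - 1)) := by
  rw [sum_tokunagaSeq_mul_succ c (fun i => a * leafMean c i + b * (leafMean c i - 1))]
  induction K with
  | zero =>
    rw [leafMean_succ hc, leafMean_zero hc]
    simp
    ring
  | succ K ih =>
    rw [sum_tokunagaSeq_mul_succ c (fun i => a * leafMean c i + b * (leafMean c i - 1)), ih,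
      leafMean_succ hc (K + 1), leafMean_succ hc K]
    ring

theorem measurable_cast_nat {α : Type*} [MeasurableSpace α] {f : α → ℕ} (hf : Measurable f) :
    Measurable fun t => ((f t : ℕ) : ℝ) :=
  measurable_from_top.comp hf

section

set_option linter.unusedSectionVars false

attribute [local instance] isProbabilityMeasure_expMeasure_of_fact

variable {c γ : ℝ} [hc : Fact (1 < c)] [hγ : Fact (0 < γ)]

theorem lintegral_criticalTree_one {f : RiverTree → ℝ≥0∞} (hf : Measurable f) :
    ∫⁻ t, f t ∂(criticalTree c γ 1) = ∫⁻ x, f (source x) ∂(expMeasure γ) := by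
  rw [criticalTree_one, lintegral_map hf measurable_source]

/-- One formula for three uses: φ = 1, ψ = 0 counts sources, φ = ψ = g gives the area, and φ = exp(θ
x), ψ = 0 gives `sourceExpSum`. -/
theorem lintegral_linkSum {φ ψ : ℝ → ℝ≥0∞} (hφ : Measurable φ) (hψ : Measurable ψ) {a b : ℝ}
    (ha : 0 ≤ a) (hb : 0 ≤ b) (hφa : ∫⁻ x, φ x ∂(expMeasure γ) = ENNReal.ofReal a)
    (hψb : ∫⁻ x, ψ x ∂(expMeasure γ) = ENNReal.ofReal b) (K : ℕ) :
    ∫⁻ t, t.linkSum φ ψ ∂(criticalTree c γ (K + 1)) =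
      ENNReal.ofReal (a * leafMean c K + b * (leafMean c K - 1)) := by
  have hc0 : 0 < c := zero_lt_one.trans hc.out
  have hm := measurable_linkSum hφ hψ
  have hnn : ∀ i, 0 ≤ a * leafMean c i + b * (leafMean c i - 1) := fun i => by
    have := one_le_leafMean hc.out i
    exact add_nonneg (mul_nonneg ha (by linarith)) (mul_nonneg hb (by linarith))
  induction K using Nat.strong_induction_on with
  | _ K ih =>
    cases K with
    | zero =>
      rw [zero_add, lintegral_criticalTree_one hm, leafMean_zero hc.out]
      simp [linkSum, hφa]
    | succ K =>
      rw [lintegral_criticalTree_of_root_additive K hm hm hψ (fun _ _ _ _ _ _ => rfl)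
        (fun _ _ _ _ _ _ _ _ => rfl), hψb, ih K (Nat.lt_succ_self K)]
      have hsum : ∑ i ∈ Finset.range (K + 1), ENNReal.ofReal (tokunagaSeq c (K + 1 - i)) *
          ∫⁻ t, t.linkSum φ ψ ∂(criticalTree c γ (i + 1)) =
            ENNReal.ofReal (∑ i ∈ Finset.range (K + 1), tokunagaSeq c (K + 1 - i) *
              (a * leafMean c i + b * (leafMean c i - 1))) := by
        rw [ENNReal.ofReal_sum_of_nonneg
          fun i _ => mul_nonneg (tokunagaSeq_nonneg hc.out _) (hnn i)]
        refine Finset.sum_congr rfl fun i hi => ?_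
        rw [ih i (Finset.mem_range.1 hi), ENNReal.ofReal_mul (tokunagaSeq_nonneg hc.out _)]
      have hs0 : 0 ≤ ∑ i ∈ Finset.range (K + 1), tokunagaSeq c (K + 1 - i) *
          (a * leafMean c i + b * (leafMean c i - 1)) :=
        Finset.sum_nonneg fun i _ => mul_nonneg (tokunagaSeq_nonneg hc.out _) (hnn i)
      rw [hsum, ← ENNReal.ofReal_mul (by positivity), ← ENNReal.ofReal_ofNat 2,
        ← ENNReal.ofReal_mul zero_le_two,
        ← ENNReal.ofReal_add (mul_nonneg zero_le_two (hnn K)) hs0,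
        ← ENNReal.ofReal_add (by positivity) (add_nonneg (mul_nonneg zero_le_two (hnn K)) hs0),
        sum_tokunagaSeq_mul_leafMean hc.out]
      congr 1
      ring

theorem meanAtOrder_criticalTokunagaLaw (f : RiverTree → ℝ) (K : ℕ) :
    meanAtOrder (criticalTokunagaLaw c γ) f (K + 1) = ∫ t, f t ∂(criticalTree c γ (K + 1)) := by
  rw [meanAtOrder, givenOrder_criticalTokunagaLaw]

theorem integral_streamCount_one (K : ℕ) :
    ∫ t, (t.streamCount 1 : ℝ) ∂(criticalTree c γ (K + 1)) = leafMean c K := by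
  have h := lintegral_linkSum (c := c) (γ := γ) (measurable_const (a := 1))
    (measurable_const (a := 0)) zero_le_one le_rfl (by simp) (by simp) K
  refine (integrable_and_integral_eq (measurable_cast_nat (measurable_streamCount 1))
    (ae_of_all _ fun t => Nat.cast_nonneg _)
    (zero_le_one.trans (one_le_leafMean hc.out K)) ?_).2
  simpa [← streamCount_one_eq_linkSum] using h

theorem integrable_and_integral_area {g : ℝ → ℝ} (hg : Measurable g)
    (hg0 : ∀ x, 0 < x → 0 ≤ g x) (hgint : Integrable g (expMeasure γ)) (K : ℕ) :
    Integrable (area g) (criticalTree c γ (K + 1)) ∧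
      ∫ t, t.area g ∂(criticalTree c γ (K + 1)) =
        (∫ x, g x ∂(expMeasure γ)) * (2 * leafMean c K - 1) := by
  have hae : 0 ≤ᵐ[expMeasure γ] g := by
    filter_upwards [ae_expMeasure_pos] with x hx using hg0 x hx
  have hnn : 0 ≤ ∫ x, g x ∂(expMeasure γ) := integral_nonneg_of_ae hae
  have hgl : ∫⁻ x, ENNReal.ofReal (g x) ∂(expMeasure γ) =
      ENNReal.ofReal (∫ x, g x ∂(expMeasure γ)) :=
    (ofReal_integral_eq_lintegral_ofReal hgint hae).symm
  have h1 := one_le_leafMean hc.out K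
  refine integrable_and_integral_eq (measurable_area hg) ?_ (mul_nonneg hnn (by linarith)) ?_
  · filter_upwards [ae_isRegular K] with t ht using ht.2.area_nonneg hg0
  · have h := lintegral_linkSum (c := c) hg.ennreal_ofReal hg.ennreal_ofReal hnn hnn hgl hgl K
    rw [show ∀ y z : ℝ, y * (2 * z - 1) = y * z + y * (z - 1) by intros; ring, ← h]
    refine lintegral_congr_ae ?_
    filter_upwards [ae_isRegular K] with t ht using ht.2.ofReal_area hg0

theorem lintegral_ofReal_expMeasure :
    ∫⁻ x, ENNReal.ofReal x ∂(expMeasure γ) = ENNReal.ofReal γ⁻¹ := by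
  have hγ0 := hγ.out
  have h := lintegral_gammaPDF_eq_one (a := 2) zero_lt_two hγ0
  -- The weight x γ exp(-γx) is 1/γ times the gamma density of shape 2 and rate γ.
  have h2 : ∫⁻ x in Set.Ici 0, ENNReal.ofReal (γ * Real.exp (-(γ * x))) * ENNReal.ofReal x =
      ENNReal.ofReal γ⁻¹ * ∫⁻ x, gammaPDF 2 γ x := by
    rw [← lintegral_const_mul' _ _ ENNReal.ofReal_ne_top, ← lintegral_indicator measurableSet_Ici]
    refine lintegral_congr fun x => ?_
    by_cases hx : 0 ≤ x
    · simp only [Set.indicator, Set.mem_Ici, hx, if_true, gammaPDF, gammaPDFReal]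
      rw [← ENNReal.ofReal_mul (by positivity), ← ENNReal.ofReal_mul (by positivity)]
      congr 1
      norm_num
      field_simp
    · simp [gammaPDF, gammaPDFReal, hx]
  rw [lintegral_expMeasure (by fun_prop), h2, h, mul_one]

/-- Tilting the density of rate γ by exp(γx/2) gives twice the density of rate γ/2. -/
theorem lintegral_exp_half_expMeasure :
    ∫⁻ x, ENNReal.ofReal (Real.exp (γ / 2 * x)) ∂(expMeasure γ) = ENNReal.ofReal 2 := by
  have hγ0 := hγ.out
  have := isProbabilityMeasure_expMeasure (half_pos hγ0)
  have h := lintegral_expMeasure (r := γ / 2) (measurable_const (a := (1 : ℝ≥0∞)))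
  rw [lintegral_const, measure_univ, mul_one] at h
  rw [lintegral_expMeasure (by fun_prop), ← mul_one (ENNReal.ofReal 2), h,
    ← lintegral_const_mul' _ _ ENNReal.ofReal_ne_top]
  refine lintegral_congr fun x => ?_
  rw [mul_one, ← ENNReal.ofReal_mul (by positivity), ← ENNReal.ofReal_mul (by positivity),
    mul_assoc, ← Real.exp_add]
  congr 1
  rw [show -(γ * x) + γ / 2 * x = -(γ / 2 * x) by ring]
  ring

theorem integral_rootStreamLength (K : ℕ) :
    ∫ t, t.rootStreamLength ∂(criticalTree c γ (K + 1)) = c ^ K / γ := by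
  have hc0 : 0 < c := zero_lt_one.trans hc.out
  have hγ0 := hγ.out
  have hm := measurable_rootStreamLength.ennreal_ofReal
  refine (integrable_and_integral_eq measurable_rootStreamLength ?_ (by positivity) ?_).2
  · filter_upwards [ae_isRegular K] with t ht using ht.2.rootStreamLength_nonneg
  cases K with
  | zero =>
    rw [zero_add, lintegral_criticalTree_one hm]
    simpa [rootStreamLength] using lintegral_ofReal_expMeasure
  | succ K =>
    rw [lintegral_criticalTree_of_root_additive K (ε := fun _ => 0) hm measurable_const
      ENNReal.measurable_ofReal]
    · rw [lintegral_ofReal_expMeasure, ← ENNReal.ofReal_mul (by positivity)]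
      simp [div_eq_mul_inv]
    · intro x a b _ ha hb
      simp [rootStreamLength, ha.1, hb.1]
    · intro i x t t' hx hi ht ht'
      have h : i + 1 < K + 2 := by omega
      simp only [rootStreamLength, ht.1, ht'.1, h, h.not_gt, if_true, if_false, zero_add]
      exact ENNReal.ofReal_add hx.le ht'.2.rootStreamLength_nonneg

/-- The mean number of trees that are attached to the root stream and have an order lower by `k`
than the whole tree. -/
noncomputable def attachedMean (c : ℝ) (k : ℕ) : ℝ := tokunagaSeq c k + if k = 1 then 2 else 0

theorem lintegral_indicator_ord (i j : ℕ) :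
    ∫⁻ t, (if t.ord = i then 1 else 0) ∂(criticalTree c γ (j + 1)) = if j + 1 = i then 1 else 0 := by
  refine (lintegral_congr_ae (g := fun _ => if j + 1 = i then 1 else 0) ?_).trans (by simp)
  filter_upwards [ae_isRegular j] with t ht
  rw [ht.1]

theorem integral_attachedCount (i k : ℕ) :
    ∫ t, (t.attachedCount (i + 1) : ℝ) ∂(criticalTree c γ (i + k + 2)) = attachedMean c (k + 1) := by
  have hm : Measurable fun t : RiverTree => ((t.attachedCount (i + 1) : ℕ) : ℝ≥0∞) :=
    measurable_from_top.comp (measurable_attachedCount (i + 1))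
  have hε : Measurable fun t : RiverTree => if t.ord = i + 1 then (1 : ℝ≥0∞) else 0 :=
    Measurable.ite (measurable_ord (measurableSet_singleton _)) measurable_const measurable_const
  have hT := tokunagaSeq_nonneg hc.out (k + 1)
  have hnn : 0 ≤ attachedMean c (k + 1) := add_nonneg hT (by split_ifs <;> norm_num)
  refine (integrable_and_integral_eq (measurable_cast_nat (measurable_attachedCount _))
    (ae_of_all _ fun t => Nat.cast_nonneg _) hnn ?_).2
  simp only [ENNReal.ofReal_natCast]
  rw [lintegral_criticalTree_of_root_additive (i + k) hm hε (β := fun _ => 0) measurable_const]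
  · simp only [lintegral_indicator_ord, lintegral_zero, mul_zero, zero_add, mul_ite, mul_one]
    -- Only side trees whose order index is `i` are counted. The two trees at the upstream end, of
    -- index i + k, contribute exactly when `k = 0`.
    rw [Finset.sum_eq_single i (fun j _ hj => if_neg (by omega))
      (fun h => absurd (Finset.mem_range.2 (by omega)) h), if_pos rfl, attachedMean,
      show i + k + 1 - i = k + 1 by omega, add_comm, ENNReal.ofReal_add hT
      (by split_ifs <;> norm_num)]
    congr 1
    by_cases hk : k = 0 <;> simp [hk]
  · intro x a b _ ha hb
    by_cases h : i + k + 1 = i + 1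
    · simp [attachedCount, ha.1, hb.1, h, one_add_one_eq_two]
    · simp only [attachedCount, ha.1, hb.1, h, lt_irrefl, if_false]
      simp
  · intro j x t t' hx hj ht ht'
    have h : j + 1 < i + k + 2 := by omega
    simp only [attachedCount, ht.1, ht'.1, h, h.not_gt, if_true, if_false, zero_add]
    push_cast
    rw [add_comm]

end

/-! ### The height of a tree and of its pruning -/

namespace RiverTree

/-- The height of the tree after its streams of order `1` have been cut off. -/
noncomputable def prunedHeight : RiverTree → ℝ
  | source _ => 0
  | junction x t₁ t₂ => x + max t₁.prunedHeight t₂.prunedHeight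

theorem measurable_prunedHeight : Measurable prunedHeight :=
  measurable_of_rec (φ := fun _ => 0) (ψ := fun q => q.1 + max q.2.1 q.2.2) measurable_const
    (by fun_prop) (fun _ => rfl) (fun _ _ _ => rfl)

theorem Positive.height_pos {t : RiverTree} (ht : t.Positive) : 0 < t.height := by
  induction t with
  | source x => exact ht
  | junction x a b ha hb => exact add_pos ht.1 (lt_max_of_lt_left (ha ht.2.1))

theorem Positive.prunedHeight_le_height {t : RiverTree} (ht : t.Positive) :
    t.prunedHeight ≤ t.height := by
  induction t with
  | source x => exact le_of_lt ht
  | junction x a b ha hb =>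
    simp only [prunedHeight, height]
    gcongr
    · exact ha ht.2.1
    · exact hb ht.2.2

/-- The sum of `exp (θ x)` over the lengths `x` of the links that end at a source. -/
noncomputable def sourceExpSum (θ : ℝ) : RiverTree → ℝ
  | source x => Real.exp (θ * x)
  | junction _ t₁ t₂ => t₁.sourceExpSum θ + t₂.sourceExpSum θ

theorem measurable_sourceExpSum (θ : ℝ) : Measurable (sourceExpSum θ) :=
  measurable_of_rec (φ := fun x => Real.exp (θ * x)) (ψ := fun q => q.2.1 + q.2.2) (by fun_prop)
    (by fun_prop) (fun _ => rfl) (fun _ _ _ => rfl)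

theorem sourceExpSum_pos (θ : ℝ) (t : RiverTree) : 0 < t.sourceExpSum θ := by
  induction t with
  | source x => exact Real.exp_pos _
  | junction x a b ha hb => exact add_pos ha hb

theorem ofReal_sourceExpSum (θ : ℝ) (t : RiverTree) : ENNReal.ofReal (t.sourceExpSum θ) =
    t.linkSum (fun x => ENNReal.ofReal (Real.exp (θ * x))) (fun _ => 0) := by
  induction t with
  | source x => rfl
  | junction x a b ha hb =>
    rw [sourceExpSum, linkSum, ENNReal.ofReal_add (sourceExpSum_pos θ a).le
      (sourceExpSum_pos θ b).le, ha, hb, zero_add]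

/-- Pruning shortens the longest path by at most the longest source link. Its log-sum-exp upper
bound is used because a sum over sources has a computable mean. -/
theorem height_le_prunedHeight_add {θ : ℝ} (hθ : 0 < θ) (t : RiverTree) :
    t.height ≤ t.prunedHeight + Real.log (t.sourceExpSum θ) / θ := by
  induction t with
  | source x => simp [height, prunedHeight, sourceExpSum, hθ.ne']
  | junction x a b ha hb =>
    have pa := sourceExpSum_pos θ a
    have pb := sourceExpSum_pos θ b
    simp only [height, prunedHeight, sourceExpSum]
    rw [add_assoc]
    gcongr
    refine max_le (ha.trans ?_) (hb.trans ?_)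
    · gcongr
      · exact le_max_left _ _
      · linarith
    · gcongr
      · exact le_max_right _ _
      · linarith

end RiverTree

/-! ### Exponential variables as geometric sums, and uniqueness for linear recursions -/

theorem measurable_exponentialPDF (r : ℝ) : Measurable (exponentialPDF r) :=
  (measurable_exponentialPDFReal r).ennreal_ofReal

theorem lintegral_expMeasure_eq_exponentialPDF {r : ℝ} {f : ℝ → ℝ≥0∞} (hf : Measurable f) :
    ∫⁻ x, f x ∂(expMeasure r) = ∫⁻ x, exponentialPDF r x * f x :=
  lintegral_withDensity_eq_lintegral_mul _ (measurable_exponentialPDF r) hf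

/-- Since exp(-rx) exp(-a(s - x)) = exp(-as) exp(-(r - a)x), integrating over the first summand x ≤
s leaves the exponential distribution function of rate r - a at s. -/
theorem exponentialPDF_mul_exponentialPDF_sub {a r : ℝ} (ha : 0 < a) (har : a < r) (x s : ℝ) :
    ENNReal.ofReal (1 - a / r) * (exponentialPDF r x * exponentialPDF a (s - x)) =
      exponentialPDF a s * (Set.Iic s).indicator (exponentialPDF (r - a)) x := by
  have hr : 0 < r := ha.trans har
  by_cases hs : x ≤ s
  · by_cases hx : 0 ≤ x
    · have hs0 := hx.trans hs
      simp only [Set.indicator, Set.mem_Iic, hs, if_true, exponentialPDF_eq, hx, hs0,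
        sub_nonneg.2 hs]
      have h1 : 0 ≤ 1 - a / r := sub_nonneg.2 ((div_le_one hr).2 har.le)
      rw [← ENNReal.ofReal_mul (by positivity), ← ENNReal.ofReal_mul h1,
        ← ENNReal.ofReal_mul (by positivity)]
      congr 1
      have h2 : Real.exp (-(r * x)) * Real.exp (-(a * (s - x))) =
          Real.exp (-(a * s)) * Real.exp (-((r - a) * x)) := by
        rw [← Real.exp_add, ← Real.exp_add]
        ring_nf
      calc _ = (1 - a / r) * r * a * (Real.exp (-(r * x)) * Real.exp (-(a * (s - x)))) := by ring
        _ = (r - a) * a * (Real.exp (-(a * s)) * Real.exp (-((r - a) * x))) := by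
          rw [h2]
          congr 2
          field_simp
        _ = _ := by ring
    · simp [exponentialPDF_of_neg (not_le.1 hx), hs]
  · simp [exponentialPDF_of_neg (sub_neg.2 (not_le.1 hs)), hs]

/-- An exponential variable with rate `a` is a geometric sum of exponential variables with the
larger rate `r`. -/
theorem lintegral_expMeasure_of_lt {a r : ℝ} (ha : 0 < a) (har : a < r) {k : ℝ → ℝ≥0∞}
    (hk : Measurable k) : ∫⁻ s, k s ∂(expMeasure a) =
      ∫⁻ x, (ENNReal.ofReal (a / r) * k x +
        ENNReal.ofReal (1 - a / r) * ∫⁻ z, k (x + z) ∂(expMeasure a)) ∂(expMeasure r) := by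
  have hr : 0 < r := ha.trans har
  have hpa := measurable_exponentialPDF a
  have hpr := measurable_exponentialPDF r
  have hshift : ∀ x, ∫⁻ z, k (x + z) ∂(expMeasure a) = ∫⁻ s, exponentialPDF a (s - x) * k s := by
    intro x
    rw [lintegral_expMeasure_eq_exponentialPDF (by fun_prop),
      ← lintegral_sub_right_eq_self (fun z => exponentialPDF a z * k (x + z)) x]
    simp
  have hsm : Measurable fun x => ∫⁻ s, exponentialPDF a (s - x) * k s :=
    Measurable.lintegral_prod_right' (f := fun q : ℝ × ℝ => exponentialPDF a (q.2 - q.1) * k q.2)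
      (by fun_prop)
  simp only [hshift]
  rw [lintegral_add_left (by fun_prop), lintegral_expMeasure_eq_exponentialPDF hk,
    lintegral_expMeasure_eq_exponentialPDF (by fun_prop),
    lintegral_expMeasure_eq_exponentialPDF (by fun_prop)]
  have h1 : ∫⁻ x, exponentialPDF r x *
      (ENNReal.ofReal (1 - a / r) * ∫⁻ s, exponentialPDF a (s - x) * k s) =
      ∫⁻ s, exponentialPDF a s * ENNReal.ofReal (if 0 ≤ s then 1 - Real.exp (-((r - a) * s)) else 0)
        * k s := by
    have h2 : ∀ x, exponentialPDF r x *
        (ENNReal.ofReal (1 - a / r) * ∫⁻ s, exponentialPDF a (s - x) * k s) =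
        ∫⁻ s, exponentialPDF a s * (Set.Iic s).indicator (exponentialPDF (r - a)) x * k s := by
      intro x
      rw [← mul_assoc, ← lintegral_const_mul _ (by fun_prop)]
      refine lintegral_congr fun s => ?_
      rw [← exponentialPDF_mul_exponentialPDF_sub ha har]
      ring
    simp_rw [h2]
    rw [lintegral_lintegral_swap]
    · refine lintegral_congr fun s => ?_
      have h3 : Measurable ((Set.Iic s).indicator (exponentialPDF (r - a))) :=
        (measurable_exponentialPDF _).indicator measurableSet_Iic
      rw [lintegral_mul_const _ (by fun_prop), lintegral_const_mul _ h3,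
        lintegral_indicator measurableSet_Iic, lintegral_exponentialPDF_eq_antiDeriv
          (sub_pos.2 har)]
    · have h4 : Measurable fun q : ℝ × ℝ =>
          (Set.Iic q.2).indicator (exponentialPDF (r - a)) q.1 :=
        Measurable.ite (measurableSet_le measurable_fst measurable_snd)
          ((measurable_exponentialPDF _).comp measurable_fst) measurable_const
      refine Measurable.aemeasurable ?_
      exact Measurable.mul (Measurable.mul (by fun_prop) h4) (by fun_prop)
  rw [h1, ← lintegral_add_left (by fun_prop)]
  refine lintegral_congr fun s => ?_
  rw [← mul_assoc, ← add_mul]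
  congr 1
  -- The densities add up as a exp(-rs) + a exp(-as) (1 - exp(-(r - a)s)) = a exp(-as).
  by_cases hs : 0 ≤ s
  · have h0 : 0 ≤ 1 - Real.exp (-((r - a) * s)) := by
      rw [sub_nonneg, Real.exp_le_one_iff]
      nlinarith
    simp only [exponentialPDF_eq, hs, if_true]
    rw [← ENNReal.ofReal_mul (by positivity), ← ENNReal.ofReal_mul (by positivity),
      ← ENNReal.ofReal_add (by positivity) (by positivity)]
    congr 1
    have h2 : Real.exp (-(r * s)) = Real.exp (-(a * s)) * Real.exp (-((r - a) * s)) := by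
      rw [← Real.exp_add]
      ring_nf
    rw [h2]
    field_simp
    ring
  · simp [exponentialPDF_of_neg (not_le.1 hs)]

theorem expMeasure_map_mul {c γ : ℝ} (hc : 0 < c) {f : ℝ → ℝ≥0∞} (hf : Measurable f) :
    ∫⁻ x, f (c * x) ∂(expMeasure γ) = ∫⁻ x, f x ∂(expMeasure (γ / c)) := by
  rw [lintegral_expMeasure_eq_exponentialPDF (by fun_prop),
    lintegral_expMeasure_eq_exponentialPDF hf]
  have hpc := measurable_exponentialPDF (γ / c)
  have h := lintegral_map (μ := volume) (f := fun x => exponentialPDF (γ / c) x * f x)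
    (g := fun x => c * x) (by fun_prop) (by fun_prop)
  rw [Real.map_volume_mul_left hc.ne', lintegral_smul_measure, abs_of_pos (inv_pos.2 hc),
    smul_eq_mul] at h
  have h' := congrArg (ENNReal.ofReal c * ·) h
  simp only [← mul_assoc] at h'
  rw [← ENNReal.ofReal_mul hc.le, mul_inv_cancel₀ hc.ne', ENNReal.ofReal_one, one_mul] at h'
  rw [h', ← lintegral_const_mul' _ _ ENNReal.ofReal_ne_top]
  refine lintegral_congr fun x => ?_
  rw [← mul_assoc]
  congr 1
  simp only [exponentialPDF_eq]
  rw [← ENNReal.ofReal_mul hc.le]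
  congr 1
  by_cases hx : 0 ≤ x
  · have : 0 ≤ c * x := by positivity
    simp only [hx, this, if_true]
    field_simp
  · have : ¬ 0 ≤ c * x := fun h => hx (nonneg_of_mul_nonneg_right h hc)
    simp [hx, this]

/-- Iterating the equation from u ≤ v + 1 gives u ≤ v + ρ^n for every n. With the roles exchanged
this becomes uniqueness of bounded solutions. -/
theorem le_of_contraction {μ : Measure ℝ} [IsProbabilityMeasure μ] {u v q r : ℝ → ℝ≥0∞} {ρ : ℝ≥0∞}
    (hρ : ρ < 1) (hr : ∀ y, r y ≤ ρ) (hu1 : ∀ y, u y ≤ 1)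
    (hu : ∀ y, u y = ∫⁻ x, (q (y - x) + r (y - x) * u (y - x)) ∂μ)
    (hv : ∀ y, v y = ∫⁻ x, (q (y - x) + r (y - x) * v (y - x)) ∂μ) (y : ℝ) : u y ≤ v y := by
  have key : ∀ (n : ℕ) y, u y ≤ v y + ρ ^ n := by
    intro n
    induction n with
    | zero => exact fun y => (hu1 y).trans (by simp)
    | succ n ih =>
      intro y
      rw [hu y, hv y]
      calc _ ≤ ∫⁻ x, (q (y - x) + r (y - x) * v (y - x) + ρ ^ (n + 1)) ∂μ := by
            refine lintegral_mono fun x => ?_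
            rw [add_assoc, pow_succ']
            refine add_le_add le_rfl ?_
            calc _ ≤ r (y - x) * (v (y - x) + ρ ^ n) := mul_le_mul' le_rfl (ih _)
              _ = r (y - x) * v (y - x) + r (y - x) * ρ ^ n := mul_add _ _ _
              _ ≤ _ := add_le_add le_rfl (mul_le_mul' (hr _) le_rfl)
        _ = _ := by
          rw [lintegral_add_right _ measurable_const]
          simp
  have hlim : Tendsto (fun n => v y + ρ ^ n) atTop (𝓝 (v y + 0)) :=
    (ENNReal.tendsto_pow_atTop_nhds_zero_of_lt_one hρ).const_add _
  rw [add_zero] at hlim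
  exact ge_of_tendsto' hlim fun n => key n y

/-! ### Distribution functions of the height and of the pruned height -/

section

set_option linter.unusedSectionVars false

attribute [local instance] isProbabilityMeasure_expMeasure_of_fact

variable {c γ : ℝ} [hc : Fact (1 < c)] [hγ : Fact (0 < γ)]

/-- The distribution function of `h` for the tree of order `K + 1`. -/
noncomputable def orderCdf (c γ : ℝ) (h : RiverTree → ℝ) (K : ℕ) (y : ℝ) : ℝ≥0∞ :=
  criticalTree c γ (K + 1) {t | h t ≤ y}

theorem orderCdf_le_one (h : RiverTree → ℝ) (K : ℕ) (y : ℝ) : orderCdf c γ h K y ≤ 1 :=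
  prob_le_one

theorem measurable_orderCdf (h : RiverTree → ℝ) (K : ℕ) : Measurable (orderCdf c γ h K) :=
  Monotone.measurable fun _ _ hyz => measure_mono fun _ ht => le_trans ht hyz

/-- A maximum is at most y - x exactly when both terms are, and the subtrees are independent, so
distribution functions multiply. Only the junction rule matters here, and `height` and
`prunedHeight` share it. -/
theorem orderCdf_succ {h : RiverTree → ℝ} (hm : Measurable h)
    (hj : ∀ x a b, h (junction x a b) = x + max (h a) (h b)) (K : ℕ) (y : ℝ) :
    orderCdf c γ h (K + 1) y = ∫⁻ x, endProb c (K + 1) *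
      (orderCdf c γ h K (y - x) ^ 2 + ∑ i ∈ Finset.range (K + 1),
        ENNReal.ofReal (tokunagaSeq c (K + 1 - i)) *
          (orderCdf c γ h i (y - x) * orderCdf c γ h (K + 1) (y - x))) ∂(expMeasure γ) := by
  have hS : ∀ z, MeasurableSet {t | h t ≤ z} := fun z => hm measurableSet_Iic
  have hind : ∀ x t t', {t | h t ≤ y}.indicator (1 : RiverTree → ℝ≥0∞) (junction x t t') =
      ({t | h t ≤ y - x} ×ˢ {t | h t ≤ y - x}).indicator 1 (t, t') := by
    intro x t t'
    have h1 : h (junction x t t') ≤ y ↔ h t ≤ y - x ∧ h t' ≤ y - x := by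
      rw [hj, ← le_sub_iff_add_le', max_le_iff]
    simp [Set.indicator, h1]
  have hind' : ∀ x t t', {t | h t ≤ y}.indicator (1 : RiverTree → ℝ≥0∞) (junction x t t') =
      {t | h t ≤ y - x}.indicator 1 t * {t | h t ≤ y - x}.indicator 1 t' := by
    intro x t t'
    rw [hind]
    by_cases h1 : h t ≤ y - x <;> by_cases h2 : h t' ≤ y - x <;> simp [h1, h2]
  rw [orderCdf, ← lintegral_indicator_one (hS y),
    lintegral_criticalTree_add_two K (measurable_one.indicator (hS y))]
  refine lintegral_congr fun x => ?_
  congr 2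
  · simp_rw [hind]
    rw [lintegral_indicator_one ((hS _).prod (hS _)), Measure.prod_prod, sq]
    rfl
  · refine Finset.sum_congr rfl fun i _ => ?_
    congr 1
    simp_rw [hind']
    rw [lintegral_congr fun t => lintegral_const_mul _ (measurable_one.indicator (hS _)),
      lintegral_mul_const _ (measurable_one.indicator (hS _)), lintegral_indicator_one (hS _),
      lintegral_indicator_one (hS _)]
    rfl

/-- The distribution functions of the pruned heights, in terms of the heights. -/
noncomputable def scaledCdf (c γ : ℝ) : ℕ → ℝ → ℝ≥0∞
  | 0, y => (Set.Ici 0).indicator 1 y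
  | K + 1, y => orderCdf c γ height K (y / c)

theorem measurable_scaledCdf (K : ℕ) : Measurable (scaledCdf c γ K) := by
  cases K with
  | zero => exact measurable_one.indicator measurableSet_Ici
  | succ K => exact (measurable_orderCdf height K).comp (measurable_id.div_const c)

theorem scaledCdf_succ_of_neg (K : ℕ) {y : ℝ} (hy : y < 0) : scaledCdf c γ (K + 1) y = 0 := by
  have hc0 : 0 < c := zero_lt_one.trans hc.out
  refine measure_eq_zero_iff_ae_notMem.2 ?_
  filter_upwards [ae_isRegular K] with t ht h
  exact absurd (ht.2.height_pos.trans_le h) (div_neg_of_neg_of_pos hy hc0).not_gt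

/-- The recursion of the height, with lengths multiplied by c. The choice of `scaledCdf` at 0 makes
it cover a tree of order 1: its link always ends the stream (`endProb c 0` is 1), with nothing above
it. -/
theorem scaledCdf_succ_eq (K : ℕ) (y : ℝ) :
    scaledCdf c γ (K + 1) y = ∫⁻ x, endProb c K * (scaledCdf c γ K (y - x) ^ 2 +
      ∑ i ∈ Finset.range K, ENNReal.ofReal (tokunagaSeq c (K - i)) *
        (scaledCdf c γ (i + 1) (y - x) * scaledCdf c γ (K + 1) (y - x)))
          ∂(expMeasure (γ / c)) := by
  have hc0 : 0 < c := zero_lt_one.trans hc.out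
  have hsc := measurable_scaledCdf (c := c) (γ := γ)
  rw [← expMeasure_map_mul hc0 (by fun_prop)]
  cases K with
  | zero =>
    have hS : MeasurableSet {t : RiverTree | t.height ≤ y / c} :=
      measurable_height measurableSet_Iic
    rw [scaledCdf, orderCdf, zero_add, ← lintegral_indicator_one hS,
      lintegral_criticalTree_one (measurable_one.indicator hS)]
    refine lintegral_congr fun x => ?_
    have hx : x ≤ y / c ↔ c * x ≤ y := by rw [le_div_iff₀ hc0, mul_comm]
    by_cases h : c * x ≤ y <;> simp [scaledCdf, endProb, Set.indicator, height, hx, h]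
  | succ K =>
    have hd : ∀ x, (y - c * x) / c = y / c - x := fun x => by field_simp
    rw [scaledCdf, orderCdf_succ measurable_height (fun _ _ _ => rfl)]
    simp only [scaledCdf, hd]

/-- The rescaled height obeys the recursion of the pruned height. A link of rate γ/c is a link of
rate γ that continues with probability 1 - 1/c. A continuation stands for a junction with a side
tree of order 1, which is pruned to height 0 and occurs with the same probability: c^(-(K+1))
T_(K+1) = 1 - 1/c. -/
theorem scaledCdf_succ (K : ℕ) (y : ℝ) :
    scaledCdf c γ (K + 1) y = ∫⁻ x, endProb c (K + 1) *
      (scaledCdf c γ K (y - x) ^ 2 + ∑ i ∈ Finset.range (K + 1),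
        ENNReal.ofReal (tokunagaSeq c (K + 1 - i)) *
          (scaledCdf c γ i (y - x) * scaledCdf c γ (K + 1) (y - x))) ∂(expMeasure γ) := by
  have hc0 : 0 < c := zero_lt_one.trans hc.out
  have hγ0 := hγ.out
  have hsc := measurable_scaledCdf (c := c) (γ := γ)
  have hlt : γ / c < γ := div_lt_self hγ0 hc.out
  have hR : Measurable fun x => endProb c K * (scaledCdf c γ K (y - x) ^ 2 +
      ∑ i ∈ Finset.range K, ENNReal.ofReal (tokunagaSeq c (K - i)) *
        (scaledCdf c γ (i + 1) (y - x) * scaledCdf c γ (K + 1) (y - x))) := by fun_prop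
  rw [scaledCdf_succ_eq, lintegral_expMeasure_of_lt (by positivity) hlt hR]
  refine lintegral_congr fun x => ?_
  simp only [← sub_sub]
  rw [← scaledCdf_succ_eq, Finset.sum_range_succ', ← mul_assoc, mul_add (endProb c (K + 1)),
    mul_add (endProb c (K + 1)), mul_add (ENNReal.ofReal _ * endProb c K), add_assoc,
    show γ / c / γ = c⁻¹ by field_simp]
  have hw : ENNReal.ofReal c⁻¹ * endProb c K = endProb c (K + 1) := by
    rw [endProb, endProb, ← ENNReal.ofReal_mul (by positivity), pow_succ, mul_inv, mul_comm]
  have hw' : endProb c (K + 1) * ENNReal.ofReal (tokunagaSeq c (K + 1)) =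
      ENNReal.ofReal (1 - c⁻¹) := by
    rw [endProb, ← ENNReal.ofReal_mul (by positivity)]
    congr 1
    simp only [tokunagaSeq, Nat.add_sub_cancel]
    field_simp
    ring
  -- The factor of a tree pruned to height 0 is 1 for nonnegative arguments; for negative ones the
  -- other factor vanishes already.
  have h0 : scaledCdf c γ 0 (y - x) * scaledCdf c γ (K + 1) (y - x) =
      scaledCdf c γ (K + 1) (y - x) := by
    by_cases h : 0 ≤ y - x
    · rw [scaledCdf, Set.indicator_of_mem (by exact h), Pi.one_apply, one_mul]
    · rw [scaledCdf_succ_of_neg K (not_le.1 h), mul_zero]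
  rw [hw, Nat.sub_zero, h0, ← mul_assoc, hw']
  congr 3
  refine Finset.sum_congr rfl fun i _ => ?_
  rw [Nat.add_sub_add_right]

theorem endProb_mul_sideMean_lt_one (K : ℕ) : endProb c K * sideMean c K < 1 := by
  have h := endProb_mul_add (c := c) K
  have h3 : endProb c K ≠ 0 := fun h0 => by
    simpa [h0] using ofReal_pow_mul_endProb (c := c) K
  refine lt_of_le_of_ne (h ▸ le_add_self) fun h1 => h3 ?_
  rw [h1] at h
  simpa using ENNReal.le_of_add_le_add_right (c := 0) ENNReal.one_ne_top (by rw [h, zero_add])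

/-- Once the lower orders agree, both functions solve the same linear equation, whose coefficient is
at most the probability of a side junction and hence below 1. -/
theorem orderCdf_prunedHeight (K : ℕ) :
    orderCdf c γ prunedHeight K = scaledCdf c γ K := by
  induction K using Nat.strong_induction_on with
  | _ K ih =>
    cases K with
    | zero =>
      funext y
      have hS : MeasurableSet {t : RiverTree | t.prunedHeight ≤ y} :=
        measurable_prunedHeight measurableSet_Iic
      rw [orderCdf, zero_add, ← lintegral_indicator_one hS,
        lintegral_criticalTree_one (measurable_one.indicator hS)]
      have hi : ∀ x, {t : RiverTree | t.prunedHeight ≤ y}.indicator (1 : RiverTree → ℝ≥0∞)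
          (source x) = scaledCdf c γ 0 y := fun x => by
        by_cases h : 0 ≤ y <;> simp [prunedHeight, scaledCdf, Set.indicator, h]
      rw [lintegral_congr hi, lintegral_const, measure_univ, mul_one]
    | succ K =>
      set q : ℝ → ℝ≥0∞ := fun y => endProb c (K + 1) * scaledCdf c γ K y ^ 2 with hq
      set r : ℝ → ℝ≥0∞ := fun y => endProb c (K + 1) * ∑ i ∈ Finset.range (K + 1),
        ENNReal.ofReal (tokunagaSeq c (K + 1 - i)) * scaledCdf c γ i y with hr
      have hsplit : ∀ (u : ℝ → ℝ≥0∞) z, endProb c (K + 1) * (scaledCdf c γ K z ^ 2 +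
          ∑ i ∈ Finset.range (K + 1), ENNReal.ofReal (tokunagaSeq c (K + 1 - i)) *
            (scaledCdf c γ i z * u z)) = q z + r z * u z := by
        intro u z
        simp only [hq, hr, mul_add, mul_assoc, Finset.sum_mul]
      have hr1 : ∀ y, r y ≤ endProb c (K + 1) * sideMean c (K + 1) := by
        intro y
        refine mul_le_mul' le_rfl (Finset.sum_le_sum fun i hi => ?_)
        rw [← ih i (Finset.mem_range.1 hi)]
        exact mul_le_of_le_one_right' (orderCdf_le_one _ _ _)
      have hu : ∀ y, orderCdf c γ prunedHeight (K + 1) y = ∫⁻ x, (q (y - x) +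
          r (y - x) * orderCdf c γ prunedHeight (K + 1) (y - x)) ∂(expMeasure γ) := by
        intro y
        simp only [← hsplit]
        rw [orderCdf_succ measurable_prunedHeight (fun _ _ _ => rfl), ih K (Nat.lt_succ_self K)]
        refine lintegral_congr fun x => ?_
        congr 2
        exact Finset.sum_congr rfl fun i hi => by rw [ih i (Finset.mem_range.1 hi)]
      have hv : ∀ y, scaledCdf c γ (K + 1) y = ∫⁻ x, (q (y - x) +
          r (y - x) * scaledCdf c γ (K + 1) (y - x)) ∂(expMeasure γ) := by
        intro y
        simp only [← hsplit]
        exact scaledCdf_succ K y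
      funext y
      exact (le_of_contraction (endProb_mul_sideMean_lt_one _) hr1
        (orderCdf_le_one _ _) hu hv y).antisymm
        (le_of_contraction (endProb_mul_sideMean_lt_one _) hr1
        (fun y => orderCdf_le_one height K _) hv hu y)

/-- Pruning a tree of the critical Tokunaga model lowers its order by `1` and scales its height. -/
theorem map_prunedHeight (K : ℕ) : (criticalTree c γ (K + 2)).map prunedHeight =
    (criticalTree c γ (K + 1)).map fun t => c * t.height := by
  have hc0 : 0 < c := zero_lt_one.trans hc.out
  have : IsProbabilityMeasure ((criticalTree c γ (K + 2)).map prunedHeight) :=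
    Measure.isProbabilityMeasure_map measurable_prunedHeight.aemeasurable
  refine Measure.ext_of_Iic _ _ fun y => ?_
  rw [Measure.map_apply measurable_prunedHeight measurableSet_Iic,
    Measure.map_apply (measurable_height.const_mul c) measurableSet_Iic]
  refine (congrFun (orderCdf_prunedHeight (c := c) (γ := γ) (K + 1)) y).trans ?_
  rw [scaledCdf, orderCdf]
  congr 1
  ext t
  simp [le_div_iff₀ hc0, mul_comm]

end

/-! ### Growth of the mean height -/

theorem exists_tendsto_of_monotone_of_le_add {a d : ℕ → ℝ} (ha : Monotone a)
    (had : ∀ K, a (K + 1) ≤ a K + d K) (hd0 : ∀ K, 0 ≤ d K) (hd : Summable d) :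
    ∃ L, a 0 ≤ L ∧ Tendsto a atTop (𝓝 L) := by
  have h1 : ∀ K, a K ≤ a 0 + ∑ i ∈ Finset.range K, d i := by
    intro K
    induction K with
    | zero => simp
    | succ K ih =>
      rw [Finset.sum_range_succ]
      linarith [had K]
  have hb : BddAbove (Set.range a) := by
    refine ⟨a 0 + ∑' i, d i, ?_⟩
    rintro _ ⟨K, rfl⟩
    exact (h1 K).trans (add_le_add le_rfl (hd.sum_le_tsum _ fun i _ => hd0 i))
  exact ⟨_, le_ciSup hb 0, tendsto_atTop_ciSup ha hb⟩

section

set_option linter.unusedSectionVars false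

attribute [local instance] isProbabilityMeasure_expMeasure_of_fact

variable {c γ : ℝ} [hc : Fact (1 < c)] [hγ : Fact (0 < γ)]

theorem integrable_and_integral_prunedHeight {K : ℕ}
    (h : Integrable height (criticalTree c γ (K + 1))) :
    Integrable prunedHeight (criticalTree c γ (K + 2)) ∧
      ∫ t, t.prunedHeight ∂(criticalTree c γ (K + 2)) =
        c * ∫ t, t.height ∂(criticalTree c γ (K + 1)) := by
  have hm := (measurable_height.const_mul c).aemeasurable (μ := criticalTree c γ (K + 1))
  have hp := measurable_prunedHeight.aemeasurable (μ := criticalTree c γ (K + 2))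
  have h1 : Integrable (fun y => y) ((criticalTree c γ (K + 2)).map prunedHeight) := by
    rw [map_prunedHeight, integrable_map_measure measurable_id'.aestronglyMeasurable hm]
    exact h.const_mul c
  have h2 : ∫ y, y ∂((criticalTree c γ (K + 2)).map prunedHeight) =
      c * ∫ t, t.height ∂(criticalTree c γ (K + 1)) := by
    rw [map_prunedHeight, integral_map hm measurable_id'.aestronglyMeasurable, integral_const_mul]
  rw [integrable_map_measure measurable_id'.aestronglyMeasurable hp] at h1
  rw [integral_map hp measurable_id'.aestronglyMeasurable] at h2
  exact ⟨h1, h2⟩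

theorem integrable_and_integral_sourceExpSum (K : ℕ) :
    Integrable (sourceExpSum (γ / 2)) (criticalTree c γ (K + 1)) ∧
      ∫ t, t.sourceExpSum (γ / 2) ∂(criticalTree c γ (K + 1)) = 2 * leafMean c K := by
  have h := lintegral_linkSum (c := c) (γ := γ) (ψ := fun _ => 0) (by fun_prop)
    (measurable_const (a := 0)) zero_le_two le_rfl lintegral_exp_half_expMeasure (by simp) K
  have h1 := one_le_leafMean hc.out K
  refine integrable_and_integral_eq (measurable_sourceExpSum _)
    (ae_of_all _ fun t => (sourceExpSum_pos _ t).le) (by linarith) ?_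
  simp only [ofReal_sourceExpSum]
  rw [h]
  ring_nf

/-- The logarithm is replaced by its tangent at `2 * leafMean c K`, the mean of the sum for θ = γ/2.
This is Jensen's inequality in a pointwise form, which also provides an integrable bound. -/
theorem height_le_affine (K : ℕ) (t : RiverTree) :
    t.height ≤ t.prunedHeight + 2 / γ *
      (Real.log (2 * leafMean c K) + (t.sourceExpSum (γ / 2) / (2 * leafMean c K) - 1)) := by
  have hγ0 := hγ.out
  have hb : 0 < 2 * leafMean c K := by linarith [one_le_leafMean hc.out K]
  have hS := sourceExpSum_pos (γ / 2) t
  refine (height_le_prunedHeight_add (half_pos hγ0) t).trans ?_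
  rw [div_eq_inv_mul, inv_div]
  gcongr
  have h := Real.log_le_sub_one_of_pos (div_pos hS hb)
  rw [Real.log_div hS.ne' hb.ne'] at h
  linarith

theorem integrable_affine (K : ℕ) : Integrable (fun t : RiverTree => 2 / γ *
    (Real.log (2 * leafMean c K) + (t.sourceExpSum (γ / 2) / (2 * leafMean c K) - 1)))
      (criticalTree c γ (K + 1)) :=
  ((integrable_const _).add (((integrable_and_integral_sourceExpSum K).1.div_const _).sub
    (integrable_const _))).const_mul _

theorem integral_affine (K : ℕ) : ∫ t : RiverTree, 2 / γ *
    (Real.log (2 * leafMean c K) + (t.sourceExpSum (γ / 2) / (2 * leafMean c K) - 1))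
      ∂(criticalTree c γ (K + 1)) = 2 / γ * Real.log (2 * leafMean c K) := by
  have hb : 2 * leafMean c K ≠ 0 := by linarith [one_le_leafMean hc.out K]
  have h := integrable_and_integral_sourceExpSum (c := c) (γ := γ) K
  have h1 : Integrable (fun t : RiverTree => t.sourceExpSum (γ / 2) / (2 * leafMean c K) - 1)
      (criticalTree c γ (K + 1)) := (h.1.div_const _).sub (integrable_const _)
  rw [integral_const_mul, integral_add (integrable_const _) h1, integral_sub (h.1.div_const _)
    (integrable_const _), integral_div, h.2, div_self hb]
  simp

theorem integrable_and_integral_height_one :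
    Integrable height (criticalTree c γ 1) ∧ ∫ t, t.height ∂(criticalTree c γ 1) = γ⁻¹ := by
  have hγ0 := hγ.out
  refine integrable_and_integral_eq measurable_height ?_ (by positivity) ?_
  · filter_upwards [ae_isRegular (c := c) (γ := γ) 0] with t ht using ht.2.height_pos.le
  · rw [lintegral_criticalTree_one measurable_height.ennreal_ofReal]
    simpa [height] using lintegral_ofReal_expMeasure

theorem integrable_height (K : ℕ) : Integrable height (criticalTree c γ (K + 1)) := by
  induction K with
  | zero => exact integrable_and_integral_height_one.1
  | succ K ih =>
    refine Integrable.mono' ((integrable_and_integral_prunedHeight ih).1.add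
      (integrable_affine (c := c) (γ := γ) (K + 1))) measurable_height.aestronglyMeasurable ?_
    filter_upwards [ae_isRegular (K + 1)] with t ht
    rw [Real.norm_eq_abs, abs_of_pos ht.2.height_pos]
    exact height_le_affine (c := c) (K + 1) t

theorem mul_integral_height_le (K : ℕ) : c * ∫ t, t.height ∂(criticalTree c γ (K + 1)) ≤
    ∫ t, t.height ∂(criticalTree c γ (K + 2)) := by
  have h := integrable_and_integral_prunedHeight (integrable_height (c := c) (γ := γ) K)
  rw [← h.2]
  refine integral_mono_ae h.1 (integrable_height (K + 1)) ?_
  filter_upwards [ae_isRegular (K + 1)] with t ht using ht.2.prunedHeight_le_height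

/-- The longest source link costs on average at most (2/γ) log(2N), with N the mean number of
sources, and N ≤ (2c)^(K+1) makes this linear in the order. -/
theorem integral_height_le (K : ℕ) : ∫ t, t.height ∂(criticalTree c γ (K + 2)) ≤
    c * ∫ t, t.height ∂(criticalTree c γ (K + 1)) + 2 / γ * (Real.log (2 * c) * (K + 2)) := by
  have hc1 := hc.out
  have hγ0 := hγ.out
  have h := integrable_and_integral_prunedHeight (integrable_height (c := c) (γ := γ) K)
  have hl : Real.log (2 * leafMean c (K + 1)) ≤ Real.log (2 * c) * (K + 2) := by
    have h1 := one_le_leafMean hc1 (K + 1)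
    have h2 : 2 * leafMean c (K + 1) ≤ (2 * c) ^ (K + 2) := by
      rw [pow_succ' (2 * c)]
      have := leafMean_le hc1 (K + 1)
      have h0 : 0 ≤ leafMean c (K + 1) := by linarith
      nlinarith
    refine (Real.log_le_log (by linarith) h2).trans_eq ?_
    rw [Real.log_pow]
    push_cast
    ring
  calc _ ≤ ∫ t : RiverTree, (t.prunedHeight + 2 / γ * (Real.log (2 * leafMean c (K + 1)) +
        (t.sourceExpSum (γ / 2) / (2 * leafMean c (K + 1)) - 1))) ∂(criticalTree c γ (K + 2)) :=
        integral_mono (integrable_height (K + 1)) (h.1.add (integrable_affine (K + 1)))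
          fun t => height_le_affine (K + 1) t
    _ = c * ∫ t, t.height ∂(criticalTree c γ (K + 1)) +
        2 / γ * Real.log (2 * leafMean c (K + 1)) := by
      rw [integral_add h.1 (integrable_affine (K + 1)), h.2, integral_affine (K + 1)]
    _ ≤ _ := by gcongr

/-- After division by c^K the means increase by at most a constant times (K + 2) c^(-(K+1)), which
is summable. The limit is positive because the first term is 1/γ. -/
theorem exists_tendsto_integral_height : ∃ L : ℝ, 0 < L ∧
    Tendsto (fun K : ℕ => (∫ t, t.height ∂(criticalTree c γ (K + 1))) / c ^ K) atTop (𝓝 L) := by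
  have hc1 := hc.out
  have hc0 : 0 < c := zero_lt_one.trans hc1
  have hγ0 := hγ.out
  have hlog : 0 ≤ Real.log (2 * c) := Real.log_nonneg (by linarith)
  have hmono : Monotone fun K : ℕ => (∫ t, t.height ∂(criticalTree c γ (K + 1))) / c ^ K := by
    refine monotone_nat_of_le_succ fun K => ?_
    rw [div_le_div_iff₀ (by positivity) (by positivity), pow_succ]
    have := mul_integral_height_le (c := c) (γ := γ) K
    have h2 : 0 < c ^ K := by positivity
    nlinarith
  have hle : ∀ K : ℕ, (∫ t, t.height ∂(criticalTree c γ (K + 2))) / c ^ (K + 1) ≤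
      (∫ t, t.height ∂(criticalTree c γ (K + 1))) / c ^ K +
        2 / γ * (Real.log (2 * c) * (K + 2)) / c ^ (K + 1) := by
    intro K
    have h : (∫ t, t.height ∂(criticalTree c γ (K + 1))) / c ^ K =
        c * (∫ t, t.height ∂(criticalTree c γ (K + 1))) / c ^ (K + 1) := by
      rw [pow_succ]
      field_simp
    rw [h, ← add_div]
    gcongr
    exact integral_height_le K
  have hsum : Summable fun K : ℕ => 2 / γ * (Real.log (2 * c) * (K + 2)) / c ^ (K + 1) := by
    have hr : ‖c⁻¹‖ < 1 := by
      rw [Real.norm_of_nonneg (by positivity)]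
      exact inv_lt_one_of_one_lt₀ hc1
    have h1 := summable_pow_mul_geometric_of_norm_lt_one 1 hr
    have h2 := summable_geometric_of_norm_lt_one hr
    refine ((h1.add (h2.mul_left 2)).mul_left (2 / γ * Real.log (2 * c) * c⁻¹)).congr fun K => ?_
    rw [pow_succ, inv_pow]
    field_simp
    ring
  obtain ⟨L, hL0, hL⟩ := exists_tendsto_of_monotone_of_le_add hmono hle
    (fun K => by positivity) hsum
  refine ⟨L, lt_of_lt_of_le ?_ hL0, hL⟩
  simp only [zero_add, pow_zero, div_one]
  rw [integrable_and_integral_height_one.2]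
  positivity

end

/-! ### The exponents -/

theorem tokunagaSeq_succ_mul_pow (c z : ℝ) (k : ℕ) :
    tokunagaSeq c (k + 1) * z ^ (k + 1) = (c - 1) * z * (c * z) ^ k := by
  rw [tokunagaSeq, Nat.add_sub_cancel, mul_pow, pow_succ]
  ring

theorem hasSum_tokunagaSeq {c : ℝ} (hc : 1 < c) :
    HasSum (fun k : ℕ => tokunagaSeq c (k + 1) * (2 * c)⁻¹ ^ (k + 1)) ((c - 1) / c) := by
  have hc0 : 0 < c := zero_lt_one.trans hc
  have hz : c * (2 * c)⁻¹ = 1 / 2 := by field_simp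
  have h := (hasSum_geometric_of_lt_one (r := 1 / 2) (by norm_num) (by norm_num)).mul_left
    ((c - 1) * (2 * c)⁻¹)
  simp only [tokunagaSeq_succ_mul_pow, hz]
  rwa [show (c - 1) * (2 * c)⁻¹ * (1 - 1 / 2)⁻¹ = (c - 1) / c by field_simp; norm_num] at h

theorem isRootOfTHat_tokunagaSeq {c : ℝ} (hc : 1 < c) :
    IsRootOfTHat (tokunagaSeq c) (2 * c)⁻¹ := by
  refine ⟨_, hasSum_tokunagaSeq hc, ?_⟩
  have hc0 : 0 < c := zero_lt_one.trans hc
  field_simp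
  ring

theorem eq_of_isRootOfTHat_tokunagaSeq {c : ℝ} (hc : 1 < c) {z : ℝ}
    (hz : z ∈ Set.Ioc (0 : ℝ) (1 / 2)) (h : IsRootOfTHat (tokunagaSeq c) z) : z = (2 * c)⁻¹ := by
  have hc0 : 0 < c := zero_lt_one.trans hc
  obtain ⟨s, hs, h0⟩ := h
  simp only [tokunagaSeq_succ_mul_pow] at hs
  have ha : (c - 1) * z ≠ 0 := (mul_pos (sub_pos.2 hc) hz.1).ne'
  -- Convergence of the geometric series is what excludes arguments beyond its radius.
  have hlt : c * z < 1 := by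
    have := summable_geometric_iff_norm_lt_one.1 ((summable_mul_left_iff ha).1 hs.summable)
    exact (le_abs_self _).trans_lt this
  have hsum := hs.unique ((hasSum_geometric_of_lt_one (mul_pos hc0 hz.1).le hlt).mul_left _)
  have h1 : 1 - c * z ≠ 0 := by linarith
  have h2 : s * (1 - c * z) = (c - 1) * z := by rw [hsum, inv_mul_cancel_right₀ h1]
  -- Multiplied by 1 - cz, the function t̂ becomes (1 - z)(2cz - 1).
  have h3 : (1 - z) * (2 * c * z - 1) = 0 := by linear_combination (1 - c * z) * h0 - h2
  have h4 : 1 - z ≠ 0 := by linarith [hz.2]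
  have h5 := (mul_eq_zero.1 h3).resolve_left h4
  refine eq_inv_of_mul_eq_one_left ?_
  linarith

theorem tendsto_leafMean_div {c : ℝ} (hc : 1 < c) :
    Tendsto (fun K : ℕ => leafMean c K / (2 * c) ^ K) atTop (𝓝 (c / (2 * c - 1))) := by
  have hD : 2 * c - 1 ≠ 0 := by linarith
  have hlim : Tendsto (fun K : ℕ => c / (2 * c - 1) + (c - 1) / (2 * c - 1) * (2 * c)⁻¹ ^ K) atTop
      (𝓝 (c / (2 * c - 1) + (c - 1) / (2 * c - 1) * 0)) :=
    ((tendsto_pow_atTop_nhds_zero_of_lt_one (inv_nonneg.2 (by linarith))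
      (inv_lt_one_of_one_lt₀ (by linarith))).const_mul _).const_add _
  rw [mul_zero, add_zero] at hlim
  refine hlim.congr fun K => ?_
  have h : (2 * c) ^ K ≠ 0 := pow_ne_zero _ (by linarith)
  rw [leafMean, inv_pow]
  generalize 2 * c - 1 = D at *
  generalize (2 * c) ^ K = P at *
  field_simp
  ring

/-! ### Horton exponents and fractal dimension -/

section

variable {c γ : ℝ} [hc : Fact (1 < c)] [hγ : Fact (0 < γ)]

theorem isStreamNumberExponent_criticalTokunagaLaw :
    IsStreamNumberExponent (criticalTokunagaLaw c γ) (2 * c) := by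
  have hc1 := hc.out
  refine ⟨by linarith, c / (2 * c - 1) / (2 * c), div_pos (div_pos (by linarith) (by linarith))
    (by linarith), (tendsto_add_atTop_iff_nat 1).1 ?_⟩
  refine ((tendsto_leafMean_div hc1).div_const (2 * c)).congr fun K => ?_
  rw [meanAtOrder_criticalTokunagaLaw, integral_streamCount_one, div_div, pow_succ]

theorem isStreamLengthExponent_criticalTokunagaLaw :
    IsStreamLengthExponent (criticalTokunagaLaw c γ) c := by
  have hc0 : 0 < c := zero_lt_one.trans hc.out
  have hγ0 := hγ.out
  refine ⟨hc.out, (γ * c)⁻¹, by positivity, fun j hj => ?_⟩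
  obtain ⟨K, rfl⟩ := Nat.exists_eq_add_of_le' hj
  rw [meanAtOrder_criticalTokunagaLaw, integral_rootStreamLength, pow_succ]
  field_simp

theorem isFractalDimension_criticalTokunagaLaw :
    IsFractalDimension (criticalTokunagaLaw c γ) c (Real.log (2 * c) / Real.log c) := by
  have hc1 := hc.out
  have hc0 : 0 < c := zero_lt_one.trans hc.out
  have hlog : 0 < Real.log c := Real.log_pos hc1
  -- The exponent d₀ is chosen so that c^(d₀) = 2c. The volume equation is then t̂(1/(2c)) = 0, for
  -- any volume, and V = 1 is taken.
  refine ⟨attachedMean c, Real.log (2 * c) / Real.log c, 1, fun i k hi hk => ?_, one_pos, ?_, ?_⟩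
  · obtain ⟨i, rfl⟩ := Nat.exists_eq_add_of_le' hi
    obtain ⟨k, rfl⟩ := Nat.exists_eq_add_of_le' hk
    rw [show i + 1 + (k + 1) = i + k + 1 + 1 by omega, meanAtOrder_criticalTokunagaLaw,
      integral_attachedCount]
  · have hp : ∀ k : ℕ, c ^ (Real.log (2 * c) / Real.log c * ((k : ℝ) + 1)) = (2 * c) ^ (k + 1) := by
      intro k
      rw [Real.rpow_mul hc0.le, Real.rpow_def_of_pos hc0, mul_div_cancel₀ _ hlog.ne',
        Real.exp_log (by positivity)]
      exact_mod_cast Real.rpow_natCast (2 * c) (k + 1)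
    -- The two trees at the upstream end enter at index 0, and the sum is (c - 1)/c + 1/c = 1.
    have h := (hasSum_tokunagaSeq hc1).add (hasSum_ite_eq 0 (2 * (2 * c)⁻¹))
    convert h using 1
    · funext k
      rw [hp, attachedMean, one_div, ← inv_pow, add_mul]
      by_cases hk : k = 0 <;> simp [hk]
    · field_simp
      ring
  · refine (max_eq_right ?_).symm
    rw [le_div_iff₀ hlog, one_mul]
    exact Real.log_le_log hc0 (by linarith)

end

/-! ### Hack's law -/

theorem theorem5 (c γ : ℝ) (hc : 1 < c) (hγ : 0 < γ)
    -- the local contributing area of a link is the function `g` of its length;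
    -- a source link, which is exponential with rate `γ`, has a finite positive mean local area
    (g : ℝ → ℝ) (hg : Measurable g) (hg0 : ∀ x, 0 < x → 0 ≤ g x)
    (hgint : Integrable g (expMeasure γ)) (hgpos : 0 < ∫ x, g x ∂(expMeasure γ)) :
    -- the average length of the longest stream and the average total contributing area exist
    (∀ i : ℕ, 1 ≤ i →
      Integrable RiverTree.height (givenOrder (criticalTokunagaLaw c γ) i) ∧
      Integrable (RiverTree.area g) (givenOrder (criticalTokunagaLaw c γ) i)) ∧
    ∃ w₀ R_B R_L d h : ℝ,
      -- `w₀` is the only root in `(0, 1/2]`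
      (w₀ ∈ Set.Ioc (0 : ℝ) (1 / 2) ∧ IsRootOfTHat (tokunagaSeq c) w₀ ∧
        ∀ z ∈ Set.Ioc (0 : ℝ) (1 / 2), IsRootOfTHat (tokunagaSeq c) z → z = w₀) ∧
      IsStreamNumberExponent (criticalTokunagaLaw c γ) R_B ∧
      IsStreamLengthExponent (criticalTokunagaLaw c γ) R_L ∧
      IsFractalDimension (criticalTokunagaLaw c γ) c d ∧
      h = d⁻¹ ∧ h = -(Real.log c / Real.log w₀) ∧ h = Real.log R_L / Real.log R_B ∧
      ∃ C : ℝ, 0 < C ∧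
        (fun i : ℕ => meanAtOrder (criticalTokunagaLaw c γ) RiverTree.height i)
          ~[atTop]
        (fun i : ℕ => C * meanAtOrder (criticalTokunagaLaw c γ) (RiverTree.area g) i ^ h) := by
  have : Fact (1 < c) := ⟨hc⟩
  have : Fact (0 < γ) := ⟨hγ⟩
  have hc0 : 0 < c := zero_lt_one.trans hc
  refine ⟨fun i hi => ?_, (2 * c)⁻¹, 2 * c, c, Real.log (2 * c) / Real.log c,
    Real.log c / Real.log (2 * c), ⟨⟨by positivity, ?_⟩, isRootOfTHat_tokunagaSeq hc,
      fun z hz h => eq_of_isRootOfTHat_tokunagaSeq hc hz h⟩,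
    isStreamNumberExponent_criticalTokunagaLaw, isStreamLengthExponent_criticalTokunagaLaw,
    isFractalDimension_criticalTokunagaLaw, (inv_div _ _).symm, ?_, rfl, ?_⟩
  · obtain ⟨K, rfl⟩ := Nat.exists_eq_add_of_le' hi
    rw [givenOrder_criticalTokunagaLaw]
    exact ⟨integrable_height K, (integrable_and_integral_area hg hg0 hgint K).1⟩
  · rw [one_div]
    exact inv_anti₀ zero_lt_two (by linarith)
  · rw [Real.log_inv, div_neg, neg_neg]
  · set h := Real.log c / Real.log (2 * c) with hh
    set G := ∫ x, g x ∂(expMeasure γ) with hG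
    obtain ⟨L, hL0, hL⟩ := exists_tendsto_integral_height (c := c) (γ := γ)
    set α := G * (2 * (c / (2 * c - 1))) with hα
    have hα0 : 0 < α :=
      mul_pos hgpos (mul_pos zero_lt_two (div_pos hc0 (by linarith)))
    have hlog : 0 < Real.log (2 * c) := Real.log_pos (by linarith)
    -- The exponent `h` is the one with (2c)^h = c, so powers of areas grow like heights.
    have hscale : ∀ K : ℕ, ((2 * c) ^ K : ℝ) ^ h = c ^ K := by
      intro K
      rw [← Real.rpow_natCast, ← Real.rpow_mul (by positivity), mul_comm (K : ℝ), Real.rpow_mul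
        (by positivity), Real.rpow_natCast, Real.rpow_def_of_pos (by positivity), hh,
        mul_div_cancel₀ _ hlog.ne', Real.exp_log hc0]
    have hA : Tendsto (fun K : ℕ => G * (2 * leafMean c K - 1) / (2 * c) ^ K) atTop (𝓝 α) := by
      have h1 := ((tendsto_leafMean_div hc).const_mul 2).sub
        (tendsto_pow_atTop_nhds_zero_of_lt_one (r := (2 * c)⁻¹) (inv_nonneg.2 (by linarith))
          (inv_lt_one_of_one_lt₀ (by linarith)))
      rw [sub_zero] at h1
      refine (h1.const_mul G).congr fun K => ?_
      rw [inv_pow]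
      field_simp
    have hA0 : ∀ K, 0 < G * (2 * leafMean c K - 1) := fun K =>
      mul_pos hgpos (by linarith [one_le_leafMean hc K])
    have hAh : Tendsto (fun K : ℕ => (G * (2 * leafMean c K - 1)) ^ h / c ^ K) atTop
        (𝓝 (α ^ h)) := by
      refine (hA.rpow_const (Or.inl hα0.ne')).congr fun K => ?_
      rw [Real.div_rpow (hA0 K).le (by positivity), hscale]
    have hαh : 0 < α ^ h := Real.rpow_pos_of_pos hα0 h
    have hC : 0 < L / α ^ h := div_pos hL0 hαh
    have hmean : ∀ K, meanAtOrder (criticalTokunagaLaw c γ) (area g) (K + 1) =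
        G * (2 * leafMean c K - 1) := fun K => by
      rw [meanAtOrder_criticalTokunagaLaw, (integrable_and_integral_area hg hg0 hgint K).2]
    -- Heights are asymptotic to L c^K and areas to α (2c)^K, at order K + 1 in both cases, which
    -- forces this constant.
    refine ⟨L / α ^ h, hC, (isEquivalent_iff_tendsto_one ?_).2
      ((tendsto_add_atTop_iff_nat 1).1 ?_)⟩
    · filter_upwards [eventually_ge_atTop 1] with i hi
      obtain ⟨K, rfl⟩ := Nat.exists_eq_add_of_le' hi
      rw [hmean]
      exact (mul_pos hC (Real.rpow_pos_of_pos (hA0 K) h)).ne'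
    · have hlim := hL.div (hAh.const_mul (L / α ^ h)) (mul_pos hC hαh).ne'
      rw [div_mul_cancel₀ _ hαh.ne', div_self hL0.ne'] at hlim
      refine hlim.congr fun K => ?_
      simp only [Pi.div_apply]
      rw [hmean, meanAtOrder_criticalTokunagaLaw, mul_div_assoc',
        div_div_div_cancel_right₀ (by positivity)]
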